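/- **Setting.** Let $(X,Y)\sim P$ with $X=(X_1,\dots,X_p)\in\mathbb{R}^p$, $Y\in\mathbb{R}$, and let $\mathcal{H}_0=\{j : Y\perp X_j\mid X_{-j}\}$ be the set of nulls. For each $j\in[p]$ let $P_j(\cdot\mid x_{-j})$ be the true conditional law of $X_j$ given $X_{-j}=x_{-j}$ and let $Q_j(\cdot\mid x_{-j})$ be an estimate of it (any Markov kernel). For almost every $x_{-j}$ both have densities with respect to a common measure $\nu_j(\cdot\mid x_{-j})$; these jointly measurable densities are written $P_j(a\mid x_{-j})$ and $Q_j(a\mid x_{-j})$ too. The knockoffs are drawn from a Markov kernel $P_{\tilde X\mid X}$ on $\mathbb{R}^p$ which, for every $j$, is pairwise exchangeable with respect to $Q_j$: for every probability distribution $D$ on $\mathbb{R}^p$ with $j$-th conditional $Q_j$ and $(X,\tilde X)\sim D\times P_{\tilde X\mid X}$, exchanging $X_j$ and $\tilde X_j$ does not change the law of $(X,\tilde X)$. The rows $(X_i,Y_i)$, $i\le n$, of the data $(\mathbf{X},\mathbf{Y})$ are i.i.d. from $P$. Given $(\mathbf{X},\mathbf{Y})$, the knockoff matrices $\tilde{\mathbf{X}}^{(1)},\dots,\tilde{\mathbf{X}}^{(M)}$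 are i.i.d., with independent rows $\tilde{\mathbf{X}}^{(m)}_i\sim P_{\tilde X\mid X}(\cdot\mid X_i)$. Let $W^{(m)}=\mathcal{W}([\mathbf{X},\tilde{\mathbf{X}}^{(m)}],\mathbf{Y})\in\mathbb{R}^p$, where $\mathcal{W}$ is measurable and swapping the columns $\mathbf{X}_j$ and $\tilde{\mathbf{X}}_j$ flips the sign of $\mathcal{W}_j$ and leaves $\mathcal{W}_k$, $k\ne j$, unchanged. **Derandomized knockoffs** with parameters $\alpha_{\mathrm{kn}},\alpha_{\mathrm{ebh}}\in(0,1)$ and $M\ge 1$. For each $m$ let $$T^{(m)}=\min\Big\{t\in\{|W^{(m)}_k|:k\in[p]\}\setminus\{0\}:\ \frac{1+\#\{k:W_k^{(m)}\le -t\}}{\#\{k:W_k^{(m)}\ge t\}}\le\alpha_{\mathrm{kn}}\ \text{ or }\ \#\{k:W_k^{(m)}\ge t\}<\frac1{\alpha_{\mathrm{kn}}}\Big\}$$ ($+\infty$ if there is no such $t$; a quotient by $0$ is $+\infty$), $$e_j^{(m)}=p\cdot\frac{\mathbf 1\{W_j^{(m)}\ge T^{(m)}\}}{1+\#\{k:W_k^{(m)}\le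 -T^{(m)}\}},\qquad e_j^{\mathrm{avg}}=\frac1M\sum_{m=1}^M e_j^{(m)}.$$ Let $e^{\mathrm{avg}}_{(1)}\ge\dots\ge e^{\mathrm{avg}}_{(p)}$ be the order statistics of the $e_j^{\mathrm{avg}}$ and let $\hat k=\max\{k\in[p]: e^{\mathrm{avg}}_{(k)}\ge p/(\alpha_{\mathrm{ebh}}k)\}$. The set of rejections is $\mathcal{S}=\{j:e_j^{\mathrm{avg}}\ge p/(\alpha_{\mathrm{ebh}}\hat k)\}$, and $\mathcal S=\emptyset$ if there is no such $k$. **Empirical KL divergence.** Let $$\widehat{\mathrm{KL}}{}_j^{(m)}=\sum_{i=1}^n\log\left(\frac{P_j(\mathbf{X}_{ij}\mid\mathbf{X}_{i,-j})}{Q_j(\mathbf{X}_{ij}\mid\mathbf{X}_{i,-j})}\cdot\frac{Q_j(\tilde{\mathbf{X}}^{(m)}_{ij}\mid\mathbf{X}_{i,-j})}{P_j(\tilde{\mathbf{X}}^{(m)}_{ij}\mid\mathbf{X}_{i,-j})}\right),\qquad \widehat{\mathrm{KL}}{}_j^{\max}=\max_{m\in[M]}\widehat{\mathrm{KL}}{}_j^{(m)},$$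 a summand being $+\infty$ if one of the four densities in it is $0$. **Theorem A.2.** For any $\alpha_{\mathrm{kn}},\alpha_{\mathrm{ebh}}\in(0,1)$ and $M\ge1$, and for every $\varepsilon\ge 0$, $$\mathbb{E}\left[\frac{\big|\{j\in\mathcal{S}\cap\mathcal{H}_0:\ \widehat{\mathrm{KL}}{}_j^{\max}\le\varepsilon\}\big|}{|\mathcal{S}|\vee1}\right]\le e^{\varepsilon}\,\alpha_{\mathrm{ebh}}.$$ Consequently, $$\mathrm{FDR}=\mathbb{E}\left[\frac{|\mathcal{S}\cap\mathcal{H}_0|}{|\mathcal{S}|\vee1}\right]\le\inf_{\varepsilon>0}\Big\{e^{\varepsilon}\,\alpha_{\mathrm{ebh}}+\mathbb{P}\Big(\max_j\widehat{\mathrm{KL}}{}_j^{\max}\ge\varepsilon\Big)\Big\}.$$ -/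

import Mathlib

open MeasureTheory ProbabilityTheory
open scoped ENNReal NNReal

namespace DerandKnockoffs

noncomputable section

/-! ### The features with one coordinate left out -/

/-- The vectors `x_{-j}`, indexed by the features other than `j`. -/
abbrev Rest (p : ℕ) (j : Fin p) : Type := {k : Fin p // k ≠ j} → ℝ

/-- The map `x ↦ x_{-j}`. -/
def rest {p : ℕ} (j : Fin p) (x : Fin p → ℝ) : Rest p j := fun k => x k.1

lemma measurable_rest {p : ℕ} (j : Fin p) : Measurable (rest (p := p) j) :=
  measurable_pi_lambda _ fun k => measurable_pi_apply k.1

/-! ### Nulls -/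

/-- `H_j`: under the joint law `P` of `(X, Y)`, the response `Y` is independent of `X_j`
conditionally on `X_{-j}`. -/
def IsNull {p : ℕ} (P : Measure ((Fin p → ℝ) × ℝ)) [IsProbabilityMeasure P] (j : Fin p) : Prop :=
  CondIndepFun (MeasurableSpace.comap (fun z : (Fin p → ℝ) × ℝ => rest j z.1) inferInstance)
    ((measurable_rest j).comp measurable_fst).comap_le
    (fun z : (Fin p → ℝ) × ℝ => z.2) (fun z : (Fin p → ℝ) × ℝ => z.1 j) P

open Classical in
/-- The set `H_0` of nulls. -/
def nulls {p : ℕ} (P : Measure ((Fin p → ℝ) × ℝ)) [IsProbabilityMeasure P] : Finset (Fin p) :=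
  Finset.univ.filter fun j => IsNull P j

/-! ### Conditional laws and pairwise exchangeability -/

/-- `D` has `j`-th conditional `Qj`: if `X ∼ D` then `X_j | X_{-j} ∼ Qj(· | X_{-j})`. -/
def HasConditional {p : ℕ} (D : Measure (Fin p → ℝ)) (j : Fin p) (Qj : Kernel (Rest p j) ℝ) :
    Prop :=
  D.map (fun x => (rest j x, x j)) = (D.map (rest j)) ⊗ₘ Qj

/-- Exchange the `j`-th coordinates of `x` and `x'`. -/
def swap {p : ℕ} (j : Fin p) (z : (Fin p → ℝ) × (Fin p → ℝ)) : (Fin p → ℝ) × (Fin p → ℝ) :=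
  (Function.update z.1 j (z.2 j), Function.update z.2 j (z.1 j))

/-- The knockoff mechanism `κ = P_{X̃ | X}` is pairwise exchangeable with respect to `Qj`: for every
law `D` on `ℝ^p` whose `j`-th conditional is `Qj`, and `(X, X̃) ∼ D × κ`, exchanging `X_j` and `X̃_j`
does not change the law of `(X, X̃)`. -/
def PairwiseExchangeable {p : ℕ} (κ : Kernel (Fin p → ℝ) (Fin p → ℝ)) (j : Fin p)
    (Qj : Kernel (Rest p j) ℝ) : Prop :=
  ∀ D : Measure (Fin p → ℝ), IsProbabilityMeasure D → HasConditional D j Qj →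
    (D ⊗ₘ κ).map (swap j) = D ⊗ₘ κ

/-- `f (· | x_{-j})` is, for almost all `x_{-j}` under `ρ`, a density (with respect to the reference
measure `ν x_{-j}`: Lebesgue measure, a counting measure, ...) of the law `K (· | x_{-j})`. -/
def IsCondDensity {p : ℕ} {j : Fin p} (ρ : Measure (Rest p j)) (K : Kernel (Rest p j) ℝ)
    (ν : Rest p j → Measure ℝ) (f : Rest p j → ℝ → ℝ≥0) : Prop :=
  Measurable (fun z : Rest p j × ℝ => f z.1 z.2) ∧
    ∀ᵐ x ∂ρ, K x = (ν x).withDensity fun a => (f x a : ℝ≥0∞)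

/-- The true conditional law `P_j (· | x_{-j})` of `X_j` given `X_{-j}`, for `X ∼ PX`. -/
def trueConditional {p : ℕ} (PX : Measure (Fin p → ℝ)) [IsFiniteMeasure PX] (j : Fin p) :
    Kernel (Rest p j) ℝ :=
  condDistrib (fun x : Fin p → ℝ => x j) (rest j) PX

/-! ### The law of the data and of the `M` knockoff copies -/

/-- `a ↦` the law of `M` independent draws from `κ a`. -/
def iidKernel {α β : Type*} [MeasurableSpace α] [MeasurableSpace β] (M : ℕ) (κ : Kernel α β)
    [IsMarkovKernel κ] : Kernel α (Fin M → β) where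
  toFun a := Measure.pi fun _ => κ a
  measurable' := by
    refine Measurable.measure_of_isPiSystem_of_isProbabilityMeasure
      (generateFrom_pi (α := fun _ : Fin M => β)).symm isPiSystem_pi ?_
    rintro _ ⟨s, hs, rfl⟩
    simp only [Measure.pi_pi]
    exact Finset.measurable_prod _ fun m _ => κ.measurable_coe (hs m (Set.mem_univ m))

/-- One row of the data: `((X_i, Y_i), (X̃_i^{(m)})_m)`. -/
abbrev Row (p M : ℕ) : Type := ((Fin p → ℝ) × ℝ) × (Fin M → Fin p → ℝ)

/-- The outcome space: `n` rows. -/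
abbrev Sample (n p M : ℕ) : Type := Fin n → Row p M

/-- The law of a row: `(X_i, Y_i) ∼ P` and, given `(X_i, Y_i)`, the `M` knockoff copies are
independent draws from `κ (X_i)`. -/
def rowLaw {p : ℕ} (M : ℕ) (P : Measure ((Fin p → ℝ) × ℝ)) (κ : Kernel (Fin p → ℝ) (Fin p → ℝ))
    [IsMarkovKernel κ] : Measure (Row p M) :=
  P ⊗ₘ (iidKernel M κ).comap Prod.fst measurable_fst

/-- The law of the whole sample: `n` independent rows. -/
def sampleLaw {p : ℕ} (n M : ℕ) (P : Measure ((Fin p → ℝ) × ℝ))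
    (κ : Kernel (Fin p → ℝ) (Fin p → ℝ)) [IsMarkovKernel κ] : Measure (Sample n p M) :=
  Measure.pi fun _ => rowLaw M P κ

/-- The `n × p` matrix of features. -/
def matX {n p M : ℕ} (ω : Sample n p M) : Fin n → Fin p → ℝ := fun i => (ω i).1.1

/-- The vector of responses. -/
def vecY {n p M : ℕ} (ω : Sample n p M) : Fin n → ℝ := fun i => (ω i).1.2

/-- The `m`-th `n × p` matrix of knockoffs. -/
def matKn {n p M : ℕ} (ω : Sample n p M) (m : Fin M) : Fin n → Fin p → ℝ := fun i => (ω i).2 m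

/-! ### Feature importance statistics -/

/-- `W ([X, X̃], Y) ∈ ℝ^p` is a valid feature importance statistic: it is measurable, and swapping
the columns `X_j` and `X̃_j` flips the sign of `W_j` and leaves the other `W_k` unchanged. -/
structure IsFeatureStatistic {n p : ℕ}
    (W : (Fin n → Fin p → ℝ) → (Fin n → Fin p → ℝ) → (Fin n → ℝ) → Fin p → ℝ) : Prop where
  measurable : Measurable
    fun z : (Fin n → Fin p → ℝ) × (Fin n → Fin p → ℝ) × (Fin n → ℝ) => W z.1 z.2.1 z.2.2
  flip : ∀ (j : Fin p) (X X' : Fin n → Fin p → ℝ) (Y : Fin n → ℝ),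
    W (fun i => (swap j (X i, X' i)).1) (fun i => (swap j (X i, X' i)).2) Y =
      Function.update (W X X' Y) j (-W X X' Y j)

/-! ### Derandomized knockoffs -/

/-- The number of `k` with `w_k ≥ t`. -/
def posCount {p : ℕ} (w : Fin p → ℝ) (t : EReal) : ℕ :=
  (Finset.univ.filter fun k => t ≤ (w k : EReal)).card

/-- The number of `k` with `w_k ≤ -t`. -/
def negCount {p : ℕ} (w : Fin p → ℝ) (t : EReal) : ℕ :=
  (Finset.univ.filter fun k => (w k : EReal) ≤ -t).card

/-- The candidate thresholds: the nonzero values `t` of the `|w_k|` at which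
`(1 + #{k : w_k ≤ -t}) / #{k : w_k ≥ t} ≤ α` (a quotient by zero being infinite) or
`#{k : w_k ≥ t} < 1 / α`. -/
def thresholdSet {p : ℕ} (α : ℝ) (w : Fin p → ℝ) : Set ℝ :=
  {t : ℝ | 0 < t ∧ (∃ k, |w k| = t) ∧
    (1 + (negCount w t : ℝ) ≤ α * posCount w t ∨ (posCount w t : ℝ) < 1 / α)}

/-- The knockoff threshold `T`, the least candidate; it is `+∞` if there is none. -/
def threshold {p : ℕ} (α : ℝ) (w : Fin p → ℝ) : EReal :=
  sInf ((fun t : ℝ => (t : EReal)) '' thresholdSet α w)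

open Classical in
/-- `e_j = p · 1{w_j ≥ T} / (1 + #{k : w_k ≤ -T})`. -/
def eValue {p : ℕ} (α : ℝ) (w : Fin p → ℝ) (j : Fin p) : ℝ :=
  p * ((if threshold α w ≤ (w j : EReal) then 1 else 0) / (1 + negCount w (threshold α w)))

/-- The average of the e-values of the `M` runs. -/
def eAvg {p M : ℕ} (α : ℝ) (w : Fin M → Fin p → ℝ) (j : Fin p) : ℝ :=
  (∑ m, eValue α (w m) j) / M

/-- The order statistics `e_(1) ≥ e_(2) ≥ ... ≥ e_(p)`; `orderStat e k` is `e_(k+1)`, since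
`k : Fin p` counts from zero. -/
def orderStat {p : ℕ} (e : Fin p → ℝ) (k : Fin p) : ℝ := e (Tuple.sort (fun j => -e j) k)

/-- `max {k ∈ {1, ..., p} : e_(k) ≥ p / (α k)}`, and `0` if this set is empty. -/
def kHat {p : ℕ} (α : ℝ) (e : Fin p → ℝ) : ℕ :=
  (Finset.univ.filter fun k : Fin p => p / (α * ((k : ℕ) + 1 : ℝ)) ≤ orderStat e k).sup
    fun k => (k : ℕ) + 1

/-- The e-BH procedure at level `α`. -/
def eBH {p : ℕ} (α : ℝ) (e : Fin p → ℝ) : Finset (Fin p) :=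
  if kHat α e = 0 then ∅ else Finset.univ.filter fun j => p / (α * kHat α e) ≤ e j

/-- The rejections of derandomized knockoffs: the e-BH procedure at level `αebh`, applied to the
averaged e-values of the `M` runs, where the `m`-th run uses the statistics
`W ([X, X̃^{(m)}], Y)` and the threshold at level `αkn`. -/
def rejections {n p M : ℕ} (αkn αebh : ℝ)
    (W : (Fin n → Fin p → ℝ) → (Fin n → Fin p → ℝ) → (Fin n → ℝ) → Fin p → ℝ)
    (ω : Sample n p M) : Finset (Fin p) :=
  eBH αebh (eAvg αkn fun m => W (matX ω) (matKn ω m) (vecY ω))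

/-- `FDR = E [|S ∩ H_0| / max (|S|, 1)]`, for a random selection `S` of features. -/
def fdr {Ω : Type*} [MeasurableSpace Ω] {p : ℕ} (μ : Measure Ω) (H₀ : Finset (Fin p))
    (S : Ω → Finset (Fin p)) : ℝ :=
  ∫ ω, (((S ω ∩ H₀).card : ℝ) / max ((S ω).card : ℝ) 1) ∂μ

/-! ### Empirical KL divergence -/

/-- `log (pa / qa · qb / pb)`, the summand of the empirical KL divergence, where `pa, qa` are the
densities of `P_j, Q_j` at the feature and `pb, qb` those at its knockoff. It is `+∞` if one of the
four densities vanishes. -/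
def logRatio (pa qa pb qb : ℝ≥0) : EReal :=
  if pa = 0 ∨ qa = 0 ∨ pb = 0 ∨ qb = 0 then ⊤
  else ((Real.log ((pa / qa : ℝ) * (qb / pb : ℝ)) : ℝ) : EReal)

/-- The empirical KL divergence of feature `j` in run `m`; `pj` and `qj` are the conditional
densities of `P_j` and `Q_j`. -/
def klHat {n p M : ℕ} (j : Fin p) (pj qj : Rest p j → ℝ → ℝ≥0) (m : Fin M) (ω : Sample n p M) :
    EReal :=
  ∑ i, logRatio (pj (rest j (matX ω i)) (matX ω i j)) (qj (rest j (matX ω i)) (matX ω i j))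
    (pj (rest j (matX ω i)) (matKn ω m i j)) (qj (rest j (matX ω i)) (matKn ω m i j))

/-- The maximum over the `M` runs. -/
def klMax {n p M : ℕ} (j : Fin p) (pj qj : Rest p j → ℝ → ℝ≥0) (ω : Sample n p M) : EReal :=
  ⨆ m : Fin M, klHat j pj qj m ω

end

end DerandKnockoffs

namespace DerandKnockoffs

/-! ### The threshold and the e-values -/

/-! Two ingredients meet: a deterministic inequality for sign vectors and a likelihood-ratio cost
for swapping one feature with its knockoff.

Deterministic part. For `j` rejected by e-BH, `1 / |S| ≤ αebh * e_j / p` (`inv_card_eBH_le`), and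
each run's e-value is at most `p * signTerm`, whose threshold and negative count do not see the sign
of `w j` (`eValue_le`). So the proportion of false discoveries with small divergence is at most
`αebh / M` times a sum of `signTerm`s over runs and nulls, each kept only where that run's
divergence is at most `ε` (`fdp_le_nullSum`). If in each summand the sign of its own `w j` is
flipped first, the sum over `j` is at most one for every `w` (`sum_signTerm_flip_le_one`).

Probabilistic part. Let `X_j` be drawn from `Q j` instead of its true conditional. For a null `j`,
swapping it with its knockoff then preserves the joint law with `Y` (`measurePreserving_rowSwap`).
The true law has density `∏ P_j / Q_j` against this one where the densities are nonzero, and `exp`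
of the empirical divergence is exactly the ratio of that density before and after the swap. Hence on
`{KL ≤ ε}` flipping the sign of `W_j` costs at most `exp ε` (`setLIntegral_runStat_le`).

Together, each run contributes at most `exp ε` in expectation (`lintegral_nullSum_le`). Only the
marginal law of each run matters, so dependence between the runs is harmless. For the FDR bound, the
event that some divergence reaches `ε` is paid for by its probability. -/

/-- The vector `w` with its `j`-th entry replaced by its absolute value. -/
def foldAbs {p : ℕ} (j : Fin p) (w : Fin p → ℝ) : Fin p → ℝ := Function.update w j |w j|

open Classical in
/-- A bound for the `j`-th e-value (up to the factor `p`) in which the threshold and the count of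
negative entries do not depend on the sign of `w j`. -/
noncomputable def signTerm {p : ℕ} (α : ℝ) (w : Fin p → ℝ) (j : Fin p) : ℝ :=
  (if threshold α (foldAbs j w) ≤ (w j : EReal) then 1 else 0) /
    (1 + negCount (foldAbs j w) (threshold α (foldAbs j w)))

variable {p : ℕ}

lemma finite_thresholdSet (α : ℝ) (w : Fin p → ℝ) : (thresholdSet α w).Finite :=
  (Set.finite_range fun k => |w k|).subset fun _ ht => ht.2.1

lemma threshold_eq_top_or_mem (α : ℝ) (w : Fin p → ℝ) :
    threshold α w = ⊤ ∨ ∃ t ∈ thresholdSet α w, threshold α w = (t : EReal) := by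
  rcases (thresholdSet α w).eq_empty_or_nonempty with h | h
  · left
    simp [threshold, h]
  · right
    -- A finite nonempty set of candidates contains its infimum.
    obtain ⟨t, ht, h'⟩ := (h.image fun t : ℝ => (t : EReal)).csInf_mem
      ((finite_thresholdSet α w).image _)
    exact ⟨t, ht, h'.symm⟩

lemma threshold_pos (α : ℝ) (w : Fin p → ℝ) : 0 < threshold α w := by
  rcases threshold_eq_top_or_mem α w with h | ⟨t, ht, h⟩
  · simp [h]
  · rw [h]
    exact_mod_cast ht.1

lemma threshold_le {α : ℝ} {w : Fin p → ℝ} {t : ℝ} (ht : t ∈ thresholdSet α w) :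
    threshold α w ≤ t :=
  sInf_le ⟨t, ht, rfl⟩

lemma signTerm_nonneg (α : ℝ) (w : Fin p → ℝ) (j : Fin p) : 0 ≤ signTerm α w j := by
  unfold signTerm
  split_ifs <;> positivity

/-- A nonzero e-value forces `w j ≥ T > 0`, so taking the absolute value of `w j` changes nothing
and the bound is an equality; otherwise the left side is zero. -/
lemma eValue_le (α : ℝ) (w : Fin p → ℝ) (j : Fin p) : eValue α w j ≤ p * signTerm α w j := by
  by_cases h : threshold α w ≤ (w j : EReal)
  · have hpos : 0 < w j := by exact_mod_cast (threshold_pos α w).trans_le h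
    have : foldAbs j w = w := by simp [foldAbs, abs_of_pos hpos]
    simp [eValue, signTerm, this]
  · have := signTerm_nonneg α w j
    simp only [eValue, if_neg h, zero_div, mul_zero]
    positivity

lemma abs_foldAbs (j : Fin p) (w : Fin p → ℝ) (k : Fin p) : |foldAbs j w k| = |w k| := by
  rcases eq_or_ne k j with rfl | h
  · simp [foldAbs]
  · simp [foldAbs, h]

lemma posCount_foldAbs {j : Fin p} {w : Fin p → ℝ} {t : ℝ} (ht : 0 < t) (hj : w j ≤ -t) :
    posCount (foldAbs j w) t = posCount w t + 1 := by
  unfold posCount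
  rw [← Finset.card_insert_of_notMem (a := j)]
  · congr 1
    ext k
    rcases eq_or_ne k j with rfl | h
    · have : t ≤ |w k| := by rw [abs_of_neg (by linarith)]; linarith
      simp [foldAbs, this]
    · simp [foldAbs, h]
  · simp only [Finset.mem_filter, Finset.mem_univ, true_and, EReal.coe_le_coe_iff, not_le]
    linarith

/-- Folding moves `j` out of the lower tail. The `1 +` in the e-value's denominator restores exactly
this lost entry. -/
lemma negCount_foldAbs {j : Fin p} {w : Fin p → ℝ} {t : ℝ} (ht : 0 < t) (hj : w j ≤ -t) :
    1 + negCount (foldAbs j w) t = negCount w t := by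
  unfold negCount
  rw [add_comm, ← Finset.card_insert_of_notMem (a := j)]
  · congr 1
    ext k
    rcases eq_or_ne k j with rfl | h
    · simp only [foldAbs, Finset.mem_insert, true_or, Finset.mem_filter, Finset.mem_univ, true_and,
        true_iff]
      exact_mod_cast hj
    · simp only [Finset.mem_insert, h, false_or, Finset.mem_filter, Finset.mem_univ, true_and]
      simp [foldAbs, h]
  · simp only [Finset.mem_filter, Finset.mem_univ, true_and, not_le]
    simp only [foldAbs, Function.update_self]
    have := abs_nonneg (w j)
    exact_mod_cast (by linarith : -t < |w j|)

/-- By symmetry, all `j` counted after a flip share one threshold. The candidate condition sees a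
vector only through its absolute values and its two tail counts. If `w j` and `w k` both lie at or
below `-t`, folding either one changes these counts in the same way, so `t` is a candidate for both
folded vectors or for neither. -/
lemma threshold_foldAbs_le {α : ℝ} {w : Fin p → ℝ} {j k : Fin p}
    (hj : threshold α (foldAbs j w) ≤ ((-w j : ℝ) : EReal))
    (hk : threshold α (foldAbs k w) ≤ ((-w k : ℝ) : EReal)) :
    threshold α (foldAbs k w) ≤ threshold α (foldAbs j w) := by
  rcases threshold_eq_top_or_mem α (foldAbs j w) with h | ⟨t, ht, h⟩
  · simp [h]
  by_contra! hlt
  rw [h] at hj hlt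
  have h1 : t ≤ -w j := by exact_mod_cast hj
  have h2 : t < -w k := by exact_mod_cast hlt.trans_le hk
  refine hlt.not_ge (threshold_le ⟨ht.1, ?_, ?_⟩)
  · simpa only [abs_foldAbs] using ht.2.1
  · have h3 := ht.2.2
    have e1 : negCount (foldAbs j w) t = negCount (foldAbs k w) t := by
      have := negCount_foldAbs ht.1 (by linarith : w j ≤ -t)
      have := negCount_foldAbs ht.1 (by linarith : w k ≤ -t)
      omega
    rw [posCount_foldAbs ht.1 (by linarith : w j ≤ -t), e1] at h3
    rwa [posCount_foldAbs ht.1 (by linarith : w k ≤ -t)]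

lemma foldAbs_flip (j : Fin p) (w : Fin p → ℝ) :
    foldAbs j (Function.update w j (-w j)) = foldAbs j w := by
  simp [foldAbs]

/-- After flipping the sign of `w j` in the `j`-th summand, the terms add up to at most one. -/
lemma sum_signTerm_flip_le_one (α : ℝ) (w : Fin p → ℝ) :
    ∑ j, signTerm α (Function.update w j (-w j)) j ≤ 1 := by
  classical
  -- `J` collects the `j` whose flipped term is nonzero. They have a common threshold `t` and all
  -- lie in the lower tail at `-t`, so each denominator, which equals `negCount w t`, is at least
  -- `J.card`.
  set J := Finset.univ.filter fun j => threshold α (foldAbs j w) ≤ ((-w j : ℝ) : EReal) with hJ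
  have hmem : ∀ j, j ∈ J ↔ threshold α (foldAbs j w) ≤ ((-w j : ℝ) : EReal) :=
    fun j => by simp only [hJ, Finset.mem_filter, Finset.mem_univ, true_and]
  have hterm : ∀ j, signTerm α (Function.update w j (-w j)) j ≤
      if j ∈ J then 1 / (J.card : ℝ) else 0 := by
    intro j
    simp only [signTerm, foldAbs_flip, Function.update_self]
    by_cases h : j ∈ J
    · rw [if_pos h, if_pos ((hmem j).1 h)]
      rcases threshold_eq_top_or_mem α (foldAbs j w) with h' | ⟨t, ht, h'⟩
      · have := (hmem j).1 h
        rw [h'] at this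
        exact absurd this (by simp)
      have hle : ∀ k ∈ J, w k ≤ -t := by
        intro k hk
        have h1 := (hmem k).1 hk
        have h2 := (threshold_foldAbs_le h1 ((hmem j).1 h)).trans h1
        rw [h'] at h2
        have : t ≤ -w k := by exact_mod_cast h2
        linarith
      have hc : J.card ≤ negCount w t := by
        refine Finset.card_le_card fun k hk => ?_
        simp only [Finset.mem_filter, Finset.mem_univ, true_and]
        exact_mod_cast hle k hk
      have h0 : 0 < J.card := Finset.card_pos.2 ⟨j, h⟩
      rw [h']
      have e : (1 + negCount (foldAbs j w) t : ℝ) = negCount w t := by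
        exact_mod_cast negCount_foldAbs ht.1 (hle j h)
      rw [e]
      gcongr
    · rw [if_neg h, if_neg (fun h' => h ((hmem j).2 h'))]
      simp
  refine (Finset.sum_le_sum fun j _ => hterm j).trans ?_
  rw [Finset.sum_ite_mem, Finset.univ_inter, Finset.sum_const, nsmul_eq_mul]
  rw [mul_one_div]
  -- This includes empty `J`, where the quotient is `0 / 0 = 0`.
  exact div_self_le_one _

/-! ### The e-BH procedure -/

/-- The `kHat` largest e-values are all at least the order statistic that passes its cutoff, so
their indices are rejected. -/
lemma kHat_le_card_eBH (α : ℝ) (e : Fin p → ℝ) : kHat α e ≤ (eBH α e).card := by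
  rcases Nat.eq_zero_or_pos (kHat α e) with h | h
  · simp [h]
  have hne : (Finset.univ.filter fun k : Fin p =>
      p / (α * ((k : ℕ) + 1 : ℝ)) ≤ orderStat e k).Nonempty := by
    by_contra hne
    rw [Finset.not_nonempty_iff_eq_empty] at hne
    simp [kHat, hne] at h
  obtain ⟨k, hk, hk'⟩ := Finset.exists_mem_eq_sup _ hne fun k : Fin p => (k : ℕ) + 1
  have hkk : kHat α e = k + 1 := hk'
  have hk2 := (Finset.mem_filter.1 hk).2
  rw [eBH, if_neg h.ne', hkk]
  -- Indices count from zero: the top `k + 1` features are the image of `Iic k` under the sorting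
  -- permutation.
  have : k + 1 = ((Finset.Iic k).image (Tuple.sort fun j => -e j)).card := by
    rw [Finset.card_image_of_injective _ (Equiv.injective _), Fin.card_Iic]
  refine this.trans_le (Finset.card_le_card fun j hj => ?_)
  obtain ⟨i, hi, rfl⟩ := Finset.mem_image.1 hj
  have hmono := Tuple.monotone_sort (fun j => -e j) (Finset.mem_Iic.1 hi)
  simp only [Function.comp_apply, neg_le_neg_iff] at hmono
  simp only [Finset.mem_filter, Finset.mem_univ, true_and]
  push_cast
  exact hk2.trans hmono

lemma inv_card_eBH_le {α : ℝ} (hα : 0 < α) {e : Fin p → ℝ} {j : Fin p} (hj : j ∈ eBH α e) :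
    1 / max ((eBH α e).card : ℝ) 1 ≤ α * e j / p := by
  have hp : (0 : ℝ) < p := by exact_mod_cast j.pos
  have hk := kHat_le_card_eBH α e
  by_cases h : kHat α e = 0
  · simp [eBH, h] at hj
  have h0 : (0 : ℝ) < kHat α e := by exact_mod_cast Nat.pos_of_ne_zero h
  have hj' : p / (α * kHat α e) ≤ e j := by
    rw [eBH, if_neg h] at hj
    simpa using hj
  calc 1 / max ((eBH α e).card : ℝ) 1 ≤ 1 / kHat α e := by
        gcongr
        exact le_max_of_le_left (by exact_mod_cast hk)
    _ = α * (p / (α * kHat α e)) / p := by field_simp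
    _ ≤ α * e j / p := by gcongr

end DerandKnockoffs

namespace DerandKnockoffs

/-! ### Measurability -/

section Measurability

variable {Ω : Type*} [MeasurableSpace Ω] {p : ℕ}

@[fun_prop]
lemma measurable_posCount {w : Ω → Fin p → ℝ} {t : Ω → EReal} (hw : Measurable w)
    (ht : Measurable t) : Measurable fun ω => posCount (w ω) (t ω) := by
  simp only [posCount, Finset.card_filter]
  refine Finset.measurable_sum _ fun k _ => Measurable.ite ?_ measurable_const measurable_const
  exact measurableSet_le ht (by fun_prop)

@[fun_prop]
lemma measurable_negCount {w : Ω → Fin p → ℝ} {t : Ω → EReal} (hw : Measurable w)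
    (ht : Measurable t) : Measurable fun ω => negCount (w ω) (t ω) := by
  simp only [negCount, Finset.card_filter]
  refine Finset.measurable_sum _ fun k _ => Measurable.ite ?_ measurable_const measurable_const
  exact measurableSet_le (by fun_prop) (continuous_neg.measurable.comp ht)

-- An infimum over the fixed index set `Fin p`, instead of over a set depending on `w`, makes
-- measurability accessible.
open Classical in
lemma threshold_eq_iInf (α : ℝ) (w : Fin p → ℝ) :
    threshold α w = ⨅ k, if |w k| ∈ thresholdSet α w then ((|w k| : ℝ) : EReal) else ⊤ := by
  refine le_antisymm (le_iInf fun k => ?_) (le_sInf ?_)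
  · split_ifs with h
    · exact threshold_le h
    · exact le_top
  · rintro _ ⟨t, ht, rfl⟩
    obtain ⟨k, rfl⟩ := ht.2.1
    exact (iInf_le _ k).trans (by rw [if_pos ht])

lemma measurable_threshold (α : ℝ) : Measurable (threshold (p := p) α) := by
  classical
  rw [funext (threshold_eq_iInf α)]
  refine Measurable.iInf fun k => Measurable.ite ?_ (by fun_prop) measurable_const
  have : {w : Fin p → ℝ | |w k| ∈ thresholdSet α w} = {w | 0 < |w k|} ∩
      ({w | 1 + (negCount w (|w k| : ℝ) : ℝ) ≤ α * posCount w (|w k| : ℝ)} ∪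
        {w | (posCount w (|w k| : ℝ) : ℝ) < 1 / α}) := by
    ext w
    simp [thresholdSet]
  rw [this]
  have hk : Measurable fun w : Fin p → ℝ => ((|w k| : ℝ) : EReal) := by fun_prop
  have h1 : Measurable fun w : Fin p → ℝ => (negCount w (|w k| : ℝ) : ℝ) :=
    measurable_from_top.comp (measurable_negCount measurable_id hk)
  have h2 : Measurable fun w : Fin p → ℝ => (posCount w (|w k| : ℝ) : ℝ) :=
    measurable_from_top.comp (measurable_posCount measurable_id hk)
  exact (measurableSet_lt measurable_const (by fun_prop)).inter
    ((measurableSet_le (by fun_prop) (by fun_prop)).union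
      (measurableSet_lt h2 measurable_const))

lemma measurable_foldAbs (j : Fin p) : Measurable (foldAbs j) := by
  unfold foldAbs
  refine measurable_pi_lambda _ fun k => ?_
  rcases eq_or_ne k j with rfl | h
  · simp only [Function.update_self]
    fun_prop
  · simp only [Function.update_of_ne h]
    fun_prop

lemma measurable_signTerm (α : ℝ) (j : Fin p) : Measurable fun w => signTerm α w j := by
  have hf := measurable_foldAbs j
  have ht := (measurable_threshold α).comp hf
  have hn : Measurable fun w => (negCount (foldAbs j w) (threshold α (foldAbs j w)) : ℝ) :=
    measurable_from_top.comp (measurable_negCount hf ht)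
  unfold signTerm
  refine Measurable.div (Measurable.ite ?_ measurable_const measurable_const)
    (measurable_const.add hn)
  exact measurableSet_le ht (by fun_prop)

lemma measurable_logRatio {a b c d : Ω → ℝ≥0} (ha : Measurable a) (hb : Measurable b)
    (hc : Measurable c) (hd : Measurable d) :
    Measurable fun ω => logRatio (a ω) (b ω) (c ω) (d ω) := by
  unfold logRatio
  refine Measurable.ite ?_ measurable_const (by fun_prop)
  exact (ha (measurableSet_singleton 0)).union ((hb (measurableSet_singleton 0)).union
    ((hc (measurableSet_singleton 0)).union (hd (measurableSet_singleton 0))))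

end Measurability

/-! ### Consequences of a bound on the empirical KL divergence -/

lemma logRatio_ne_bot (a b c d : ℝ≥0) : logRatio a b c d ≠ ⊥ := by
  unfold logRatio
  split_ifs
  · simp
  · exact EReal.coe_ne_bot _

/-- Excluding `⊥` is essential: in `EReal`, `⊤ + ⊥ = ⊥`, so a `⊥` could hide an infinite summand. -/
lemma ne_top_of_sum_ne_top {ι : Type*} {s : Finset ι} {f : ι → EReal}
    (hf : ∀ i ∈ s, f i ≠ ⊥) (hs : ∑ i ∈ s, f i ≠ ⊤) : ∀ i ∈ s, f i ≠ ⊤ := by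
  classical
  intro i hi h
  have hb : ∀ t ⊆ s, ∑ k ∈ t, f k ≠ ⊥ := by
    intro t ht
    induction t using Finset.induction_on with
    | empty => simp
    | insert a t ha ih =>
      rw [Finset.sum_insert ha]
      have h1 := hf a (ht (Finset.mem_insert_self a t))
      have h2 := ih ((Finset.subset_insert a t).trans ht)
      simp [EReal.add_eq_bot_iff, h1, h2]
  refine hs ?_
  rw [← Finset.add_sum_erase s f hi, h]
  exact EReal.top_add_of_ne_bot (hb _ (Finset.erase_subset i s))

/-- A finite bound rules out the value `⊤`, so all four densities are nonzero in every row;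
exponentiating then compares the likelihood ratio at the features with that at the knockoffs. -/
lemma prod_div_le_of_sum_logRatio_le {ι : Type*} [Fintype ι] {a b c d : ι → ℝ≥0} {ε : ℝ}
    (h : ∑ i, logRatio (a i) (b i) (c i) (d i) ≤ (ε : EReal)) :
    (∀ i, a i ≠ 0 ∧ b i ≠ 0) ∧
      ∏ i, ((a i / b i : ℝ≥0) : ℝ≥0∞) ≤
        ENNReal.ofReal (Real.exp ε) * ∏ i, ((c i / d i : ℝ≥0) : ℝ≥0∞) := by
  have hne : ∀ i, ¬(a i = 0 ∨ b i = 0 ∨ c i = 0 ∨ d i = 0) := by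
    intro i hi
    refine ne_top_of_sum_ne_top (fun i _ => logRatio_ne_bot _ _ _ _)
      (h.trans_lt (EReal.coe_lt_top ε)).ne i (Finset.mem_univ i) ?_
    rw [logRatio, if_pos hi]
  have hne' : ∀ i, a i ≠ 0 ∧ b i ≠ 0 ∧ c i ≠ 0 ∧ d i ≠ 0 := by
    intro i
    have := hne i
    tauto
  refine ⟨fun i => ⟨(hne' i).1, (hne' i).2.1⟩, ?_⟩
  have hpos : ∀ i, (0 : ℝ) < a i ∧ (0 : ℝ) < b i ∧ (0 : ℝ) < c i ∧ (0 : ℝ) < d i := fun i => by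
    have := hne' i
    refine ⟨?_, ?_, ?_, ?_⟩ <;> · norm_cast; exact pos_iff_ne_zero.2 (by tauto)
  simp only [logRatio, if_neg (hne _)] at h
  have h2 : ∑ i, Real.log ((a i / b i : ℝ) * (d i / c i : ℝ)) ≤ ε := by
    rw [← EReal.coe_le_coe_iff]
    refine le_of_eq_of_le ?_ h
    exact map_sum (⟨⟨Real.toEReal, EReal.coe_zero⟩, EReal.coe_add⟩ : ℝ →+ EReal) _ _
  have hp : ∀ i, 0 < (a i / b i : ℝ) * (d i / c i : ℝ) := fun i => by
    obtain ⟨h1, h2, h3, h4⟩ := hpos i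
    positivity
  rw [← Real.log_prod (fun i _ => (hp i).ne'),
    Real.log_le_iff_le_exp (Finset.prod_pos fun i _ => hp i), Finset.prod_mul_distrib] at h2
  have h3 : ∏ i, (d i / c i : ℝ) = (∏ i, (c i / d i : ℝ))⁻¹ := by
    rw [← Finset.prod_inv_distrib]
    exact Finset.prod_congr rfl fun i _ => (inv_div _ _).symm
  have h4 : 0 < ∏ i, (c i / d i : ℝ) := Finset.prod_pos fun i _ => by
    obtain ⟨h1, h2, h3, h4⟩ := hpos i
    positivity
  rw [h3, ← div_eq_mul_inv, div_le_iff₀ h4] at h2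
  have e : ∀ u v : ι → ℝ≥0, ∏ i, ((u i / v i : ℝ≥0) : ℝ≥0∞) =
      ENNReal.ofReal (∏ i, (u i / v i : ℝ)) := by
    intro u v
    rw [← ENNReal.ofNNReal_finsetProd, ENNReal.ofReal, ENNReal.coe_inj]
    refine NNReal.coe_injective ?_
    rw [Real.coe_toNNReal _ (by positivity)]
    push_cast
    rfl
  rw [e, e, ← ENNReal.ofReal_mul (Real.exp_pos ε).le]
  exact ENNReal.ofReal_le_ofReal h2

end DerandKnockoffs

namespace DerandKnockoffs

/-! ### Change of measure for independent rows -/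

section ChangeOfMeasure

variable {α β : Type*} [MeasurableSpace α] [MeasurableSpace β]

lemma lintegral_pi_prod {ι : Type*} [Fintype ι] (μ : Measure α) [IsProbabilityMeasure μ]
    {f : ι → α → ℝ≥0∞} (hf : ∀ i, Measurable (f i)) :
    ∫⁻ x, ∏ i, f i (x i) ∂(Measure.pi fun _ : ι => μ) = ∏ i, ∫⁻ a, f i a ∂μ := by
  have h := (iIndepFun_pi (μ := fun _ : ι => μ) (X := f) fun i => (hf i).aemeasurable)
  rw [lintegral_prod_eq_prod_lintegral_of_indepFun Finset.univ
    (fun i (x : ι → α) => f i (x i)) h fun i => (hf i).comp (measurable_pi_apply i)]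
  refine Finset.prod_congr rfl fun i _ => ?_
  exact (measurePreserving_eval (fun _ : ι => μ) i).lintegral_comp (hf i)

/-- Checked on boxes, where the integral of a product of one-coordinate functions factorizes. -/
lemma pi_withDensity {ι : Type*} [Fintype ι] (μ : Measure α) [IsProbabilityMeasure μ]
    {f : α → ℝ≥0∞} (hf : Measurable f) [SigmaFinite (μ.withDensity f)] :
    Measure.pi (fun _ : ι => μ.withDensity f) =
      (Measure.pi fun _ : ι => μ).withDensity fun x => ∏ i, f (x i) := by
  classical
  refine Measure.pi_eq fun s hs => ?_
  rw [withDensity_apply _ (MeasurableSet.univ_pi hs),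
    ← lintegral_indicator (MeasurableSet.univ_pi hs)]
  calc _ = ∫⁻ x, ∏ i, (s i).indicator f (x i) ∂(Measure.pi fun _ : ι => μ) := by
        refine lintegral_congr fun x => ?_
        by_cases hx : x ∈ Set.univ.pi s
        · rw [Set.indicator_of_mem hx]
          exact Finset.prod_congr rfl fun i _ =>
            (Set.indicator_of_mem (hx i (Set.mem_univ i)) f).symm
        · rw [Set.indicator_of_notMem hx]
          obtain ⟨i, hi⟩ : ∃ i, x i ∉ s i := by simpa [Set.mem_pi] using hx
          exact (Finset.prod_eq_zero (Finset.mem_univ i) (Set.indicator_of_notMem hi f)).symm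
    _ = ∏ i, μ.withDensity f (s i) := by
        rw [lintegral_pi_prod μ fun i => hf.indicator (hs i)]
        exact Finset.prod_congr rfl fun i _ => by
          rw [lintegral_indicator (hs i), withDensity_apply _ (hs i)]

lemma withDensity_compProd (μ : Measure α) [SFinite μ] (κ : Kernel α β) [IsSFiniteKernel κ]
    {f : α → ℝ≥0∞} (hf : Measurable f) :
    (μ.withDensity f) ⊗ₘ κ = (μ ⊗ₘ κ).withDensity fun z => f z.1 := by
  ext s hs
  have h1 : Measurable fun a => κ a (Prod.mk a ⁻¹' s) := Kernel.measurable_kernel_prodMk_left hs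
  rw [Measure.compProd_apply hs, lintegral_withDensity_eq_lintegral_mul _ hf h1,
    withDensity_apply _ hs, ← lintegral_indicator hs,
    Measure.lintegral_compProd
      (Measurable.indicator (f := fun z : α × β => f z.1) (hf.comp measurable_fst) hs)]
  refine lintegral_congr fun a => ?_
  have : ∀ b, s.indicator (fun z : α × β => f z.1) (a, b) =
      (Prod.mk a ⁻¹' s).indicator (fun _ => f a) b := fun b => rfl
  simp only [this, Pi.mul_apply]
  rw [lintegral_indicator_const (hs.preimage (by fun_prop))]

lemma restrict_compProd (μ : Measure α) [SFinite μ] (κ : Kernel α β) [IsSFiniteKernel κ]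
    {A : Set α} (hA : MeasurableSet A) :
    (μ.restrict A) ⊗ₘ κ = (μ ⊗ₘ κ).restrict (Prod.fst ⁻¹' A) := by
  rw [← withDensity_indicator_one hA, ← withDensity_indicator_one (hA.preimage measurable_fst),
    withDensity_compProd μ κ (measurable_one.indicator hA)]
  rfl

/-- If `μ` has density `ρ` on `A` with respect to a law `μ'` preserved by the involution `s`, and
if `∏ ρ (x i) ≤ c ∏ ρ (s (x i))` on `B`, then applying `s` to all rows costs at most a factor `c`
on `B`. -/
lemma setLIntegral_pi_le_of_involutive {ι : Type*} [Fintype ι] {μ μ' : Measure α}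
    [IsProbabilityMeasure μ] [IsProbabilityMeasure μ'] {s : α → α}
    (hs : MeasurePreserving s μ' μ') (hss : Function.Involutive s) {A : Set α} {ρ : α → ℝ≥0∞}
    (hρ : Measurable ρ) (hA : μ.restrict A = μ'.withDensity ρ) {B : Set (ι → α)}
    (hB : MeasurableSet B) (hBA : ∀ x ∈ B, ∀ i, x i ∈ A) {c : ℝ≥0∞}
    (hc : ∀ x ∈ B, ∏ i, ρ (x i) ≤ c * ∏ i, ρ (s (x i))) {h : (ι → α) → ℝ≥0∞}
    (hh : Measurable h) :
    ∫⁻ x in B, h x ∂(Measure.pi fun _ => μ) ≤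
      c * ∫⁻ x, h (fun i => s (x i)) ∂(Measure.pi fun _ => μ) := by
  have : IsFiniteMeasure (μ'.withDensity ρ) := hA ▸ inferInstance
  have hpi : (Measure.pi fun _ : ι => μ).restrict (Set.univ.pi fun _ => A) =
      (Measure.pi fun _ : ι => μ').withDensity fun x => ∏ i, ρ (x i) := by
    rw [Measure.restrict_pi_pi]
    simp only [hA]
    exact pi_withDensity μ' hρ
  have hρ' : Measurable fun x : ι → α => ∏ i, ρ (x i) :=
    Finset.measurable_fun_prod _ fun i _ => hρ.comp (measurable_pi_apply i)
  have hS : MeasurePreserving (fun (x : ι → α) i => s (x i)) (Measure.pi fun _ => μ')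
      (Measure.pi fun _ => μ') := by
    have h1 : ∀ _ : ι, μ'.map s = μ' := fun _ => hs.map_eq
    have : ∀ _ : ι, SigmaFinite (μ'.map s) := fun i => by rw [h1 i]; infer_instance
    refine ⟨measurable_pi_lambda _ fun i => hs.measurable.comp (measurable_pi_apply i), ?_⟩
    rw [Measure.pi_map_pi (fun _ => hs.measurable.aemeasurable)]
    simp only [hs.map_eq]
  have hsub : B ⊆ Set.univ.pi fun _ => A := fun x hx i _ => hBA x hx i
  have hF : Measurable fun x : ι → α => (∏ i, ρ (x i)) * h (fun i => s (x i)) :=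
    hρ'.mul (hh.comp hS.measurable)
  calc ∫⁻ x in B, h x ∂(Measure.pi fun _ => μ)
      = ∫⁻ x, B.indicator h x ∂((Measure.pi fun _ : ι => μ).restrict (Set.univ.pi fun _ => A)) := by
        rw [lintegral_indicator hB, Measure.restrict_restrict hB,
          Set.inter_eq_self_of_subset_left hsub]
    _ = ∫⁻ x, (∏ i, ρ (x i)) * B.indicator h x ∂(Measure.pi fun _ => μ') := by
        rw [hpi, lintegral_withDensity_eq_lintegral_mul _ hρ' (hh.indicator hB)]
        rfl
    _ ≤ ∫⁻ x, c * ((∏ i, ρ (s (x i))) * h x) ∂(Measure.pi fun _ => μ') := by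
        refine lintegral_mono fun x => ?_
        by_cases hx : x ∈ B
        · rw [Set.indicator_of_mem hx, ← mul_assoc]
          exact mul_le_mul_left (hc x hx) _
        · simp [Set.indicator_of_notMem hx]
    _ = c * ∫⁻ x, (∏ i, ρ (s (x i))) * h x ∂(Measure.pi fun _ => μ') :=
        lintegral_const_mul _ ((hρ'.comp hS.measurable).mul hh)
    _ = c * ∫⁻ x, (∏ i, ρ (x i)) * h (fun i => s (x i)) ∂(Measure.pi fun _ => μ') := by
        -- Change of variables by the swap, which preserves the reference law; being an involution,
        -- it moves from the density onto `h`.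
        rw [← hS.lintegral_comp hF]
        simp only [hss _]
    _ = c * ∫⁻ x, h (fun i => s (x i))
          ∂((Measure.pi fun _ : ι => μ).restrict (Set.univ.pi fun _ => A)) := by
        rw [hpi, lintegral_withDensity_eq_lintegral_mul _ hρ'
          (g := fun x => h fun i => s (x i)) (hh.comp hS.measurable)]
        rfl
    _ ≤ c * ∫⁻ x, h (fun i => s (x i)) ∂(Measure.pi fun _ => μ) := by
        gcongr
        exact Measure.restrict_le_self

end ChangeOfMeasure

end DerandKnockoffs

namespace DerandKnockoffs

/-! ### The law of one row with a single knockoff copy -/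

section Row

variable {p : ℕ}

/-- The vector with `j`-th entry `a` and remaining entries `x`. -/
def insertCoord (j : Fin p) (x : Rest p j) (a : ℝ) : Fin p → ℝ :=
  fun k => if h : k = j then a else x ⟨k, h⟩

lemma measurable_insertCoord (j : Fin p) :
    Measurable fun z : Rest p j × ℝ => insertCoord j z.1 z.2 := by
  refine measurable_pi_lambda _ fun k => ?_
  by_cases h : k = j
  · simp only [insertCoord, h, dite_true]
    exact measurable_snd
  · simp only [insertCoord, h, dite_false]
    exact (measurable_pi_apply _).comp measurable_fst

@[simp]
lemma rest_insertCoord (j : Fin p) (x : Rest p j) (a : ℝ) : rest j (insertCoord j x a) = x := by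
  ext k
  simp [rest, insertCoord, k.2]

@[simp]
lemma insertCoord_self (j : Fin p) (x : Rest p j) (a : ℝ) : insertCoord j x a j = a := by
  simp [insertCoord]

@[simp]
lemma insertCoord_rest (j : Fin p) (x : Fin p → ℝ) : insertCoord j (rest j x) (x j) = x := by
  ext k
  by_cases h : k = j
  · subst h
    simp
  · simp [rest, insertCoord, h]

/-- The law of `(X, Y)` when `(X_{-j}, Y) ∼ π` and `X_j ∼ K (· | X_{-j})` is drawn independently of
`Y` given `X_{-j}`. -/
noncomputable def nullLaw {j : Fin p} (π : Measure (Rest p j × ℝ)) (K : Kernel (Rest p j) ℝ) :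
    Measure ((Fin p → ℝ) × ℝ) :=
  (π ⊗ₘ K.prodMkRight ℝ).map fun z => (insertCoord j z.1.1 z.2, z.1.2)

lemma measurable_nullLaw_aux (j : Fin p) :
    Measurable fun z : (Rest p j × ℝ) × ℝ => (insertCoord j z.1.1 z.2, z.1.2) :=
  ((measurable_insertCoord j).comp
    ((measurable_fst.comp measurable_fst).prodMk measurable_snd)).prodMk
    (measurable_snd.comp measurable_fst)

instance {j : Fin p} (π : Measure (Rest p j × ℝ)) [IsProbabilityMeasure π]
    (K : Kernel (Rest p j) ℝ) [IsMarkovKernel K] : IsProbabilityMeasure (nullLaw π K) :=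
  Measure.isProbabilityMeasure_map (measurable_nullLaw_aux j).aemeasurable

lemma lintegral_nullLaw {j : Fin p} (π : Measure (Rest p j × ℝ)) [IsProbabilityMeasure π]
    (K : Kernel (Rest p j) ℝ) [IsMarkovKernel K] {f : (Fin p → ℝ) × ℝ → ℝ≥0∞}
    (hf : Measurable f) :
    ∫⁻ z, f z ∂(nullLaw π K) = ∫⁻ u, ∫⁻ a, f (insertCoord j u.1 a, u.2) ∂(K u.1) ∂π := by
  rw [nullLaw, lintegral_map hf (measurable_nullLaw_aux j),
    Measure.lintegral_compProd (f := fun z : (Rest p j × ℝ) × ℝ =>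
      f (insertCoord j z.1.1 z.2, z.1.2)) (hf.comp (measurable_nullLaw_aux j))]
  rfl

/-- The law of `(X_{-j}, Y)`. -/
noncomputable def restLaw (j : Fin p) (P : Measure ((Fin p → ℝ) × ℝ)) :
    Measure (Rest p j × ℝ) :=
  P.map fun z => (rest j z.1, z.2)

lemma measurable_restLaw_aux (j : Fin p) :
    Measurable fun z : (Fin p → ℝ) × ℝ => (rest j z.1, z.2) :=
  ((measurable_rest j).comp measurable_fst).prodMk measurable_snd

instance (j : Fin p) (P : Measure ((Fin p → ℝ) × ℝ)) [IsProbabilityMeasure P] :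
    IsProbabilityMeasure (restLaw j P) :=
  Measure.isProbabilityMeasure_map (measurable_restLaw_aux j).aemeasurable

lemma restLaw_map_fst (j : Fin p) (P : Measure ((Fin p → ℝ) × ℝ)) :
    (restLaw j P).map Prod.fst = (P.map Prod.fst).map (rest j) := by
  rw [restLaw, Measure.map_map measurable_fst (measurable_restLaw_aux j),
    Measure.map_map (measurable_rest j) measurable_fst]
  rfl

instance (PX : Measure (Fin p → ℝ)) [IsFiniteMeasure PX] (j : Fin p) :
    IsMarkovKernel (trueConditional PX j) := by
  unfold trueConditional
  infer_instance

/-- For a null feature, `X_j` is drawn from its conditional law given `X_{-j}`, independently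
of `Y`. -/
lemma IsNull.eq_nullLaw {P : Measure ((Fin p → ℝ) × ℝ)} [IsProbabilityMeasure P] {j : Fin p}
    (h : IsNull P j) : nullLaw (restLaw j P) (trueConditional (P.map Prod.fst) j) = P := by
  have hX : Measurable fun z : (Fin p → ℝ) × ℝ => z.1 j :=
    (measurable_pi_apply j).comp measurable_fst
  have hR : Measurable fun z : (Fin p → ℝ) × ℝ => rest j z.1 :=
    (measurable_rest j).comp measurable_fst
  have h1 := (condIndepFun_iff_condDistrib_prod_ae_eq_prodMkRight hX measurable_snd hR).1 h
  -- The true conditional is defined from the law of `X` alone; this transfers it to the joint law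
  -- of `(X, Y)`.
  have h2 := condDistrib_map (ν := P) (f := Prod.fst) (X := rest j) (Y := fun x => x j)
    (measurable_rest j).aemeasurable (measurable_pi_apply j).aemeasurable
    measurable_fst.aemeasurable
  have h3 := compProd_map_condDistrib (mβ := inferInstance) (μ := P)
    (X := fun z => (rest j z.1, z.2)) hX.aemeasurable
  have h4 : (condDistrib (fun z : (Fin p → ℝ) × ℝ => z.1 j) (fun z => (rest j z.1, z.2)) P)
      =ᵐ[restLaw j P] (trueConditional (P.map Prod.fst) j).prodMkRight ℝ := by
    refine h1.trans ?_
    have h5 : P.map ((rest j) ∘ Prod.fst) = (restLaw j P).map Prod.fst := by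
      rw [restLaw_map_fst, Measure.map_map (measurable_rest j) measurable_fst]
    rw [h5] at h2
    filter_upwards [ae_of_ae_map measurable_fst.aemeasurable h2] with u hu
    exact hu.symm
  rw [nullLaw, ← Measure.compProd_congr h4, restLaw, h3,
    Measure.map_map (measurable_nullLaw_aux j) ((measurable_restLaw_aux j).prodMk hX)]
  convert! Measure.map_id
  ext z : 1
  simp

/-- Replacing the conditional law of `X_j` by another one with a density with respect to the same
reference measure. -/
lemma nullLaw_restrict_eq_withDensity {j : Fin p} {π : Measure (Rest p j × ℝ)}
    [IsProbabilityMeasure π] {K L : Kernel (Rest p j) ℝ} [IsMarkovKernel K] [IsMarkovKernel L]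
    {ν : Rest p j → Measure ℝ} {f g : Rest p j → ℝ → ℝ≥0}
    (hf : IsCondDensity (π.map Prod.fst) K ν f) (hg : IsCondDensity (π.map Prod.fst) L ν g) :
    (nullLaw π K).restrict {z | f (rest j z.1) (z.1 j) ≠ 0 ∧ g (rest j z.1) (z.1 j) ≠ 0} =
      (nullLaw π L).withDensity
        fun z => ((f (rest j z.1) (z.1 j) / g (rest j z.1) (z.1 j) : ℝ≥0) : ℝ≥0∞) := by
  have hm : Measurable fun z : (Fin p → ℝ) × ℝ => (rest j z.1, z.1 j) :=
    ((measurable_rest j).comp measurable_fst).prodMk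
      ((measurable_pi_apply j).comp measurable_fst)
  have hf' := hf.1.comp hm
  have hg' := hg.1.comp hm
  have hA : MeasurableSet {z : (Fin p → ℝ) × ℝ |
      f (rest j z.1) (z.1 j) ≠ 0 ∧ g (rest j z.1) (z.1 j) ≠ 0} :=
    (hf' (measurableSet_singleton 0).compl).inter (hg' (measurableSet_singleton 0).compl)
  have hr : Measurable fun z : (Fin p → ℝ) × ℝ =>
      ((f (rest j z.1) (z.1 j) / g (rest j z.1) (z.1 j) : ℝ≥0) : ℝ≥0∞) :=
    measurable_coe_nnreal_ennreal.comp (hf'.div hg')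
  ext s hs
  rw [Measure.restrict_apply hs, withDensity_apply _ hs, ← lintegral_indicator_one (hs.inter hA),
    ← lintegral_indicator hs, lintegral_nullLaw _ _ (measurable_one.indicator (hs.inter hA)),
    lintegral_nullLaw _ _ (hr.indicator hs)]
  refine lintegral_congr_ae ?_
  filter_upwards [ae_of_ae_map measurable_fst.aemeasurable hf.2,
    ae_of_ae_map measurable_fst.aemeasurable hg.2] with u hu1 hu2
  have hi : Measurable fun a => (insertCoord j u.1 a, u.2) :=
    ((measurable_insertCoord j).comp measurable_prodMk_left).prodMk measurable_const
  have hfu : Measurable (f u.1) := hf.1.comp measurable_prodMk_left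
  have hgu : Measurable (g u.1) := hg.1.comp measurable_prodMk_left
  have e1 := lintegral_withDensity_eq_lintegral_mul (ν u.1) hfu.coe_nnreal_ennreal
    ((measurable_one.indicator (hs.inter hA)).comp hi)
  have e2 := lintegral_withDensity_eq_lintegral_mul (ν u.1) hgu.coe_nnreal_ennreal
    ((hr.indicator hs).comp hi)
  simp only [Function.comp_def] at e1 e2
  rw [hu1, hu2, e1, e2]
  refine lintegral_congr fun a => ?_
  simp only [Pi.mul_apply]
  by_cases hsa : (insertCoord j u.1 a, u.2) ∈ s
  · rw [Set.indicator_of_mem hsa]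
    simp only [rest_insertCoord, insertCoord_self]
    -- Against the common reference measure the claim is the pointwise identity `f = g * (f / g)`.
    -- The restriction is needed because `K` may charge the set where `g` vanishes; off the
    -- restricted set both sides are zero.
    by_cases hfg : f u.1 a ≠ 0 ∧ g u.1 a ≠ 0
    · have hm : (insertCoord j u.1 a, u.2) ∈ s ∩ {z |
          f (rest j z.1) (z.1 j) ≠ 0 ∧ g (rest j z.1) (z.1 j) ≠ 0} := ⟨hsa, by simpa using hfg⟩
      rw [Set.indicator_of_mem hm, Pi.one_apply, mul_one,
        ← ENNReal.coe_mul, mul_div_cancel₀ _ hfg.2]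
    · rw [Set.indicator_of_notMem fun h => hfg (by simpa using h.2), mul_zero, ← ENNReal.coe_mul]
      by_cases hfa : f u.1 a = 0
      · simp [hfa]
      · simp [show g u.1 a = 0 by tauto]
  · rw [Set.indicator_of_notMem hsa, Set.indicator_of_notMem fun h => hsa h.1]
    simp

/-! ### Exchanging a feature with its knockoff in one row -/

/-- The law of `((X, Y), X̃)`, where `(X, Y) ∼ P` and `X̃ ∼ κ (X)`. -/
noncomputable def pairLaw (P : Measure ((Fin p → ℝ) × ℝ))
    (κ : Kernel (Fin p → ℝ) (Fin p → ℝ)) : Measure (((Fin p → ℝ) × ℝ) × (Fin p → ℝ)) :=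
  P ⊗ₘ κ.comap Prod.fst measurable_fst

instance (P : Measure ((Fin p → ℝ) × ℝ)) [IsProbabilityMeasure P]
    (κ : Kernel (Fin p → ℝ) (Fin p → ℝ)) [IsMarkovKernel κ] :
    IsProbabilityMeasure (pairLaw P κ) := by
  unfold pairLaw
  infer_instance

/-- Exchange the `j`-th feature and its knockoff in a row `((X, Y), X̃)`. -/
def rowSwap (j : Fin p) (r : ((Fin p → ℝ) × ℝ) × (Fin p → ℝ)) :
    ((Fin p → ℝ) × ℝ) × (Fin p → ℝ) :=
  (((swap j (r.1.1, r.2)).1, r.1.2), (swap j (r.1.1, r.2)).2)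

lemma measurable_swap (j : Fin p) : Measurable (swap j) := by
  unfold swap
  refine Measurable.prodMk ?_ ?_ <;>
  · refine measurable_pi_lambda _ fun k => ?_
    rcases eq_or_ne k j with rfl | h
    · simp only [Function.update_self]
      fun_prop
    · simp only [Function.update_of_ne h]
      fun_prop

lemma measurable_rowSwap (j : Fin p) : Measurable (rowSwap j) := by
  have h : Measurable fun r : ((Fin p → ℝ) × ℝ) × (Fin p → ℝ) => swap j (r.1.1, r.2) :=
    (measurable_swap j).comp ((measurable_fst.comp measurable_fst).prodMk measurable_snd)
  exact (h.fst.prodMk (measurable_snd.comp measurable_fst)).prodMk h.snd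

lemma rowSwap_involutive (j : Fin p) : Function.Involutive (rowSwap j) := by
  rintro ⟨⟨x, y⟩, x'⟩
  simp [rowSwap, swap]

lemma rest_swap (j : Fin p) (z : (Fin p → ℝ) × (Fin p → ℝ)) :
    rest j (swap j z).1 = rest j z.1 := by
  ext k
  simp [rest, swap, k.2]

/-- Normalization extends exchangeability to finite measures, such as the law of `X` restricted to
an event on `Y`. -/
lemma PairwiseExchangeable.map_swap_eq {κ : Kernel (Fin p → ℝ) (Fin p → ℝ)} [IsMarkovKernel κ]
    {j : Fin p} {K : Kernel (Rest p j) ℝ} [IsMarkovKernel K] (h : PairwiseExchangeable κ j K)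
    (D : Measure (Fin p → ℝ)) [IsFiniteMeasure D] (hD : HasConditional D j K) :
    (D ⊗ₘ κ).map (swap j) = D ⊗ₘ κ := by
  by_cases h0 : D = 0
  · simp [h0]
  have : NeZero D := ⟨h0⟩
  set c := (D Set.univ)⁻¹ with hc
  have hc0 : c ≠ 0 := ENNReal.inv_ne_zero.2 (measure_ne_top _ _)
  have hct : c ≠ ∞ := ENNReal.inv_ne_top.2 (Measure.measure_univ_ne_zero.2 h0)
  have hP : IsProbabilityMeasure (c • D) := isProbabilityMeasureSMul
  have h1 := h (c • D) hP (by
    unfold HasConditional at hD ⊢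
    rw [Measure.map_smul, Measure.map_smul, hD, Measure.compProd_smul_left])
  rw [Measure.compProd_smul_left, Measure.map_smul] at h1
  have h2 := congrArg (fun μ => c⁻¹ • μ) h1
  simpa only [smul_smul, ENNReal.inv_mul_cancel hc0 hct, one_smul] using h2

/-- Under `nullLaw`, `X_j` is drawn from `K` without looking at `Y`, so restricting to `Y ∈ B`
leaves its conditional given `X_{-j}` unchanged. -/
lemma hasConditional_restrict_nullLaw {j : Fin p} (π : Measure (Rest p j × ℝ))
    [IsProbabilityMeasure π] (K : Kernel (Rest p j) ℝ) [IsMarkovKernel K] {B : Set ℝ}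
    (hB : MeasurableSet B) :
    HasConditional (((nullLaw π K).restrict (Prod.snd ⁻¹' B)).map Prod.fst) j K := by
  have hm : Measurable fun x : Fin p → ℝ => (rest j x, x j) :=
    (measurable_rest j).prodMk (measurable_pi_apply j)
  have hres : ((((nullLaw π K).restrict (Prod.snd ⁻¹' B)).map Prod.fst).map (rest j)) =
      (π.restrict (Prod.snd ⁻¹' B)).map Prod.fst := by
    ext s hs
    rw [Measure.map_apply (measurable_rest j) hs,
      Measure.map_apply measurable_fst (measurable_rest j hs),
      Measure.restrict_apply (measurable_fst (measurable_rest j hs)),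
      Measure.map_apply measurable_fst hs, Measure.restrict_apply (measurable_fst hs), nullLaw,
      Measure.map_apply (measurable_nullLaw_aux j)
        ((measurable_fst (measurable_rest j hs)).inter (measurable_snd hB))]
    have : (fun z : (Rest p j × ℝ) × ℝ => (insertCoord j z.1.1 z.2, z.1.2)) ⁻¹'
        (Prod.fst ⁻¹' (rest j ⁻¹' s) ∩ Prod.snd ⁻¹' B) =
        (Prod.fst ⁻¹' s ∩ Prod.snd ⁻¹' B) ×ˢ Set.univ := by
      ext z
      simp
    rw [this, Measure.compProd_apply_prod ((measurable_fst hs).inter (measurable_snd hB))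
      MeasurableSet.univ]
    simp
  unfold HasConditional
  rw [hres]
  refine Measure.ext_prod fun {s t} hs ht => ?_
  have hst : MeasurableSet ((fun x : Fin p → ℝ => (rest j x, x j)) ⁻¹' s ×ˢ t) := hm (hs.prod ht)
  rw [Measure.map_apply hm (hs.prod ht), Measure.map_apply measurable_fst hst,
    Measure.restrict_apply (measurable_fst hst), nullLaw,
    Measure.map_apply (measurable_nullLaw_aux j) ((measurable_fst hst).inter (measurable_snd hB)),
    Measure.compProd_apply_prod hs ht, setLIntegral_map hs (K.measurable_coe ht) measurable_fst,
    Measure.restrict_restrict (measurable_fst hs)]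
  have : (fun z : (Rest p j × ℝ) × ℝ => (insertCoord j z.1.1 z.2, z.1.2)) ⁻¹'
      (Prod.fst ⁻¹' ((fun x : Fin p → ℝ => (rest j x, x j)) ⁻¹' s ×ˢ t) ∩ Prod.snd ⁻¹' B) =
      (Prod.fst ⁻¹' s ∩ Prod.snd ⁻¹' B) ×ˢ t := by
    ext z
    simp
    tauto
  rw [this, Measure.compProd_apply_prod ((measurable_fst hs).inter (measurable_snd hB)) ht]
  rfl

/-- With the estimated conditional in place of the true one, swapping a null feature with its
knockoff does not change the law of a row. -/
lemma measurePreserving_rowSwap {κ : Kernel (Fin p → ℝ) (Fin p → ℝ)} [IsMarkovKernel κ]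
    {j : Fin p} {K : Kernel (Rest p j) ℝ} [IsMarkovKernel K] (h : PairwiseExchangeable κ j K)
    (π : Measure (Rest p j × ℝ)) [IsProbabilityMeasure π] :
    MeasurePreserving (rowSwap j) (pairLaw (nullLaw π K) κ) (pairLaw (nullLaw π K) κ) := by
  refine ⟨measurable_rowSwap j, ?_⟩
  set μ := pairLaw (nullLaw π K) κ with hμ
  let e : ((Fin p → ℝ) × ℝ) × (Fin p → ℝ) → ((Fin p → ℝ) × (Fin p → ℝ)) × ℝ :=
    fun r => ((r.1.1, r.2), r.1.2)
  let e' : ((Fin p → ℝ) × (Fin p → ℝ)) × ℝ → ((Fin p → ℝ) × ℝ) × (Fin p → ℝ) :=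
    fun r => ((r.1.1, r.2), r.1.2)
  have he : Measurable e := by fun_prop
  have he' : Measurable e' := by fun_prop
  have hS := measurable_swap j
  -- Exchangeability says nothing about `Y`. Fixing an event `Y ∈ B` and applying it to the
  -- restricted law of `X` gives invariance on all rectangles `E ×ˢ B`, hence jointly with `Y`.
  have key : ∀ {E : Set ((Fin p → ℝ) × (Fin p → ℝ))} {B : Set ℝ}, MeasurableSet E →
      MeasurableSet B → μ.map e (E ×ˢ B) =
        (((nullLaw π K).restrict (Prod.snd ⁻¹' B)).map Prod.fst ⊗ₘ κ) E := by
    intro E B hE hB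
    rw [Measure.map_apply he (hE.prod hB), hμ, pairLaw,
      Measure.compProd_apply (he (hE.prod hB)), Measure.compProd_apply hE,
      lintegral_map (Kernel.measurable_kernel_prodMk_left hE) measurable_fst,
      ← lintegral_indicator (measurable_snd hB)]
    refine lintegral_congr fun z => ?_
    by_cases hz : z.2 ∈ B
    · rw [Set.indicator_of_mem (by exact hz), Kernel.comap_apply]
      congr 1
      ext x
      simp [e, hz]
    · rw [Set.indicator_of_notMem (by exact hz)]
      have : Prod.mk z ⁻¹' (e ⁻¹' E ×ˢ B) = ∅ := by
        ext x
        simp [e, hz]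
      rw [this, measure_empty]
  have hmap : (μ.map e).map (Prod.map (swap j) id) = μ.map e := by
    have : IsFiniteMeasure (μ.map e) := inferInstance
    refine Measure.ext_prod fun {E B} hE hB => ?_
    rw [Measure.map_apply (hS.prodMap measurable_id) (hE.prod hB), Set.preimage_prod_map_prod,
      Set.preimage_id, key (hS hE) hB, key hE hB, ← Measure.map_apply hS hE,
      h.map_swap_eq _ (hasConditional_restrict_nullLaw π K hB)]
  calc μ.map (rowSwap j) = ((μ.map e).map (Prod.map (swap j) id)).map e' := by
        rw [Measure.map_map (hS.prodMap measurable_id) he,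
          Measure.map_map he' ((hS.prodMap measurable_id).comp he)]
        rfl
    _ = μ := by
        rw [hmap, Measure.map_map he' he]
        exact Measure.map_id

lemma rowLaw_map_eval {M : ℕ} (P : Measure ((Fin p → ℝ) × ℝ)) [IsProbabilityMeasure P]
    (κ : Kernel (Fin p → ℝ) (Fin p → ℝ)) [IsMarkovKernel κ] (m : Fin M) :
    (rowLaw M P κ).map (fun z => (z.1, z.2 m)) = pairLaw P κ := by
  have hm : Measurable fun x : Fin M → Fin p → ℝ => x m := measurable_pi_apply m
  have : IsMarkovKernel (iidKernel M κ) := ⟨fun a => by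
    change IsProbabilityMeasure (Measure.pi fun _ => κ a)
    infer_instance⟩
  have hfst : Measurable (Prod.fst : (Fin p → ℝ) × ℝ → Fin p → ℝ) := measurable_fst
  have h : κ.comap Prod.fst hfst =
      ((iidKernel M κ).comap Prod.fst hfst).map fun x : Fin M → Fin p → ℝ => x m := by
    ext1 (z : (Fin p → ℝ) × ℝ)
    rw [Kernel.map_apply _ hm]
    exact (measurePreserving_eval (fun _ : Fin M => κ z.1) m).map_eq.symm
  rw [pairLaw, h, Measure.compProd_map hm]
  rfl

end Row

end DerandKnockoffs

namespace DerandKnockoffs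

/-! ### A single run of the knockoff filter -/

section Run

variable {n p M : ℕ}

/-- The data of a single run: `n` rows `((X_i, Y_i), X̃_i)`. -/
abbrev Run (n p : ℕ) : Type := Fin n → ((Fin p → ℝ) × ℝ) × (Fin p → ℝ)

/-- The data of the `m`-th run. -/
def runOf (m : Fin M) (ω : Sample n p M) : Run n p := fun i => ((ω i).1, (ω i).2 m)

/-- The feature importance statistics of a run. -/
def runStat (W : (Fin n → Fin p → ℝ) → (Fin n → Fin p → ℝ) → (Fin n → ℝ) → Fin p → ℝ)
    (r : Run n p) : Fin p → ℝ :=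
  W (fun i => (r i).1.1) (fun i => (r i).2) (fun i => (r i).1.2)

/-- The empirical KL divergence of feature `j` in a run. -/
noncomputable def runKL (j : Fin p) (f g : Rest p j → ℝ → ℝ≥0) (r : Run n p) : EReal :=
  ∑ i, logRatio (f (rest j (r i).1.1) ((r i).1.1 j)) (g (rest j (r i).1.1) ((r i).1.1 j))
    (f (rest j (r i).1.1) ((r i).2 j)) (g (rest j (r i).1.1) ((r i).2 j))

lemma klHat_eq_runKL (j : Fin p) (f g : Rest p j → ℝ → ℝ≥0) (m : Fin M) (ω : Sample n p M) :
    klHat j f g m ω = runKL j f g (runOf m ω) := rfl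

lemma measurable_runOf (m : Fin M) : Measurable (runOf (n := n) (p := p) m) := by
  refine measurable_pi_lambda _ fun i => ?_
  have h : Measurable fun ω : Sample n p M => ω i := measurable_pi_apply i
  exact h.fst.prodMk ((measurable_pi_apply m).comp h.snd)

lemma IsFeatureStatistic.measurable_runStat
    {W : (Fin n → Fin p → ℝ) → (Fin n → Fin p → ℝ) → (Fin n → ℝ) → Fin p → ℝ}
    (hW : IsFeatureStatistic W) : Measurable (runStat W) :=
  hW.measurable.comp (f := fun r : Run n p =>
    ((fun i => (r i).1.1), (fun i => (r i).2), (fun i => (r i).1.2))) (by fun_prop)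

lemma IsFeatureStatistic.runStat_rowSwap
    {W : (Fin n → Fin p → ℝ) → (Fin n → Fin p → ℝ) → (Fin n → ℝ) → Fin p → ℝ}
    (hW : IsFeatureStatistic W) (j : Fin p) (r : Run n p) :
    runStat W (fun i => rowSwap j (r i)) =
      Function.update (runStat W r) j (-runStat W r j) :=
  hW.flip j (fun i => (r i).1.1) (fun i => (r i).2) (fun i => (r i).1.2)

lemma measurable_runKL {j : Fin p} {f g : Rest p j → ℝ → ℝ≥0}
    (hf : Measurable fun z : Rest p j × ℝ => f z.1 z.2)
    (hg : Measurable fun z : Rest p j × ℝ => g z.1 z.2) :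
    Measurable (runKL (n := n) j f g) := by
  refine Finset.measurable_fun_sum _ fun i _ => ?_
  have hr : Measurable fun r : Run n p => rest j (r i).1.1 :=
    (measurable_rest j).comp (by fun_prop)
  have h1 : Measurable fun r : Run n p => (rest j (r i).1.1, (r i).1.1 j) :=
    hr.prodMk (by fun_prop)
  have h2 : Measurable fun r : Run n p => (rest j (r i).1.1, (r i).2 j) :=
    hr.prodMk (by fun_prop)
  exact measurable_logRatio (hf.comp h1) (hg.comp h1) (hf.comp h2) (hg.comp h2)

/-- Each run on its own is an i.i.d. sample of rows with a single knockoff copy. -/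
lemma sampleLaw_map_runOf (P : Measure ((Fin p → ℝ) × ℝ)) [IsProbabilityMeasure P]
    (κ : Kernel (Fin p → ℝ) (Fin p → ℝ)) [IsMarkovKernel κ] (m : Fin M) :
    (sampleLaw n M P κ).map (runOf m) = Measure.pi fun _ => pairLaw P κ := by
  have hm : Measurable fun z : Row p M => (z.1, z.2 m) := by fun_prop
  have : ∀ _ : Fin n, SigmaFinite ((rowLaw M P κ).map fun z : Row p M => (z.1, z.2 m)) :=
    fun _ => by rw [rowLaw_map_eval]; infer_instance
  have h := Measure.pi_map_pi (hμ := this) (μ := fun _ : Fin n => rowLaw M P κ)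
    (f := fun _ (z : Row p M) => (z.1, z.2 m)) fun _ => hm.aemeasurable
  simp only [rowLaw_map_eval] at h
  exact h

/-- On the event that the empirical KL divergence of a null feature `j` is at most `ε`, flipping
the sign of `W_j` costs at most a factor `exp ε`. -/
lemma setLIntegral_runStat_le {P : Measure ((Fin p → ℝ) × ℝ)} [IsProbabilityMeasure P]
    {j : Fin p} (hj : IsNull P j) {K : Kernel (Rest p j) ℝ} [IsMarkovKernel K]
    {κ : Kernel (Fin p → ℝ) (Fin p → ℝ)} [IsMarkovKernel κ] (hκ : PairwiseExchangeable κ j K)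
    {ν : Rest p j → Measure ℝ} {f g : Rest p j → ℝ → ℝ≥0}
    (hf : IsCondDensity ((P.map Prod.fst).map (rest j)) (trueConditional (P.map Prod.fst) j) ν f)
    (hg : IsCondDensity ((P.map Prod.fst).map (rest j)) K ν g)
    {W : (Fin n → Fin p → ℝ) → (Fin n → Fin p → ℝ) → (Fin n → ℝ) → Fin p → ℝ}
    (hW : IsFeatureStatistic W) (ε : ℝ) {h : (Fin p → ℝ) → ℝ≥0∞} (hh : Measurable h) :
    ∫⁻ r in {r | runKL j f g r ≤ (ε : EReal)}, h (runStat W r)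
        ∂(Measure.pi fun _ : Fin n => pairLaw P κ) ≤
      ENNReal.ofReal (Real.exp ε) * ∫⁻ r, h (Function.update (runStat W r) j (-runStat W r j))
        ∂(Measure.pi fun _ : Fin n => pairLaw P κ) := by
  rw [← restLaw_map_fst] at hf hg
  have hnull := nullLaw_restrict_eq_withDensity hf hg
  rw [hj.eq_nullLaw] at hnull
  have hm : Measurable fun z : (Fin p → ℝ) × ℝ => (rest j z.1, z.1 j) :=
    ((measurable_rest j).comp measurable_fst).prodMk
      ((measurable_pi_apply j).comp measurable_fst)
  have hf' := hf.1.comp hm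
  have hg' := hg.1.comp hm
  have hA : MeasurableSet {z : (Fin p → ℝ) × ℝ |
      f (rest j z.1) (z.1 j) ≠ 0 ∧ g (rest j z.1) (z.1 j) ≠ 0} :=
    (hf' (measurableSet_singleton 0).compl).inter (hg' (measurableSet_singleton 0).compl)
  have hr : Measurable fun z : (Fin p → ℝ) × ℝ =>
      ((f (rest j z.1) (z.1 j) / g (rest j z.1) (z.1 j) : ℝ≥0) : ℝ≥0∞) :=
    measurable_coe_nnreal_ennreal.comp (hf'.div hg')
  -- The density involves only `(X, Y)`, so it is unaffected by attaching the knockoff through the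
  -- same kernel `κ`.
  have hpair := congrArg (fun μ => pairLaw μ κ) hnull
  simp only [pairLaw] at hpair
  rw [restrict_compProd _ _ hA, withDensity_compProd _ _ hr] at hpair
  change (pairLaw P κ).restrict _ = (pairLaw (nullLaw (restLaw j P) K) κ).withDensity _ at hpair
  have key := fun r (hr : r ∈ {r : Run n p | runKL j f g r ≤ (ε : EReal)}) =>
    prod_div_le_of_sum_logRatio_le hr
  have := setLIntegral_pi_le_of_involutive (ι := Fin n)
    (measurePreserving_rowSwap hκ (restLaw j P)) (rowSwap_involutive j)
    (hr.comp measurable_fst) hpair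
    (B := {r | runKL j f g r ≤ (ε : EReal)})
    (measurable_runKL hf.1 hg.1 measurableSet_Iic) (fun r hr i => (key r hr).1 i)
    (c := ENNReal.ofReal (Real.exp ε)) (fun r hr => by
      refine (key r hr).2.trans_eq ?_
      -- The swap keeps `X_{-j}` and puts the knockoff in place of `X_j`, so the density ratio of
      -- the swapped row is the one evaluated at the knockoff.
      simp only [rowSwap, rest_swap, Function.comp_apply]
      simp [swap]) (hh.comp hW.measurable_runStat)
  simpa only [Function.comp_apply, hW.runStat_rowSwap] using this

end Run

end DerandKnockoffs

namespace DerandKnockoffs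

/-! ### Combining the runs -/

section Combine

variable {n p M : ℕ}

open Classical in
/-- The sum over all runs and all null features with small empirical KL divergence of the bounds
for the e-values. -/
noncomputable def nullSum (α : ℝ)
    (W : (Fin n → Fin p → ℝ) → (Fin n → Fin p → ℝ) → (Fin n → ℝ) → Fin p → ℝ)
    (H₀ : Finset (Fin p)) (f g : (j : Fin p) → Rest p j → ℝ → ℝ≥0) (ε : ℝ)
    (ω : Sample n p M) : ℝ :=
  ∑ m : Fin M, ∑ j ∈ H₀, if klHat j (f j) (g j) m ω ≤ (ε : EReal) then
    signTerm α (runStat W (runOf m ω)) j else 0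

open Classical in
/-- The proportion of false discoveries with small empirical KL divergence. -/
lemma fdp_le_nullSum (αkn : ℝ) {αebh : ℝ} (hα : 0 < αebh)
    (W : (Fin n → Fin p → ℝ) → (Fin n → Fin p → ℝ) → (Fin n → ℝ) → Fin p → ℝ)
    (H₀ : Finset (Fin p)) (f g : (j : Fin p) → Rest p j → ℝ → ℝ≥0) (ε : ℝ)
    (ω : Sample n p M) :
    (((rejections αkn αebh W ω ∩ H₀).filter
        fun j => klMax j (f j) (g j) ω ≤ (ε : EReal)).card : ℝ) /
      max ((rejections αkn αebh W ω).card : ℝ) 1 ≤ αebh / M * nullSum αkn W H₀ f g ε ω := by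
  set S := rejections αkn αebh W ω with hS
  have hterm : ∀ j ∈ H₀, (if j ∈ S ∧ klMax j (f j) (g j) ω ≤ (ε : EReal) then
      1 / max (S.card : ℝ) 1 else 0) ≤ αebh / M * ∑ m : Fin M,
        if klHat j (f j) (g j) m ω ≤ (ε : EReal) then
          signTerm αkn (runStat W (runOf m ω)) j else 0 := by
    intro j _
    have hp : (0 : ℝ) < p := by exact_mod_cast j.pos
    split_ifs with h
    -- The maximum over runs enters only here: it makes every run pass its own indicator.
    · have hle : ∀ m, klHat j (f j) (g j) m ω ≤ (ε : EReal) := fun m =>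
        (le_iSup (fun m => klHat j (f j) (g j) m ω) m).trans h.2
      simp only [hle, if_true]
      calc 1 / max (S.card : ℝ) 1
          ≤ αebh * eAvg αkn (fun m => runStat W (runOf m ω)) j / p := inv_card_eBH_le hα h.1
        _ ≤ αebh * ((∑ m : Fin M, p * signTerm αkn (runStat W (runOf m ω)) j) / M) / p := by
            unfold eAvg
            gcongr with m
            exact eValue_le _ _ _
        _ = αebh / M * ∑ m : Fin M, signTerm αkn (runStat W (runOf m ω)) j := by
            rw [← Finset.mul_sum]
            field_simp
    · refine mul_nonneg (by positivity) (Finset.sum_nonneg fun m _ => ?_)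
      split_ifs
      · exact signTerm_nonneg _ _ _
      · exact le_rfl
  calc _ = ∑ j ∈ H₀, (if j ∈ S ∧ klMax j (f j) (g j) ω ≤ (ε : EReal) then
        1 / max (S.card : ℝ) 1 else 0) := by
        rw [← Finset.sum_filter, Finset.sum_const, nsmul_eq_mul, mul_one_div]
        congr 3
        ext j
        simp only [Finset.mem_filter, Finset.mem_inter]
        tauto
    _ ≤ _ := Finset.sum_le_sum hterm
    _ = _ := by rw [← Finset.mul_sum, Finset.sum_comm, nullSum]

variable {P : Measure ((Fin p → ℝ) × ℝ)} [IsProbabilityMeasure P]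
  {Q : (j : Fin p) → Kernel (Rest p j) ℝ} [∀ j, IsMarkovKernel (Q j)]
  {κ : Kernel (Fin p → ℝ) (Fin p → ℝ)} [IsMarkovKernel κ]
  {ν : (j : Fin p) → Rest p j → Measure ℝ} {pd qd : (j : Fin p) → Rest p j → ℝ → ℝ≥0}
  {W : (Fin n → Fin p → ℝ) → (Fin n → Fin p → ℝ) → (Fin n → ℝ) → Fin p → ℝ}

/-- By linearity the runs are treated separately, and each contributes at most `exp ε`. -/
lemma lintegral_nullSum_le (α : ℝ) (hκ : ∀ j, PairwiseExchangeable κ j (Q j))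
    (hpd : ∀ j, IsCondDensity ((P.map Prod.fst).map (rest j))
      (trueConditional (P.map Prod.fst) j) (ν j) (pd j))
    (hqd : ∀ j, IsCondDensity ((P.map Prod.fst).map (rest j)) (Q j) (ν j) (qd j))
    (hW : IsFeatureStatistic W) (ε : ℝ) :
    Measurable (nullSum (M := M) α W (nulls P) pd qd ε) ∧
      ∫⁻ ω, ENNReal.ofReal (nullSum α W (nulls P) pd qd ε ω) ∂(sampleLaw n M P κ) ≤
        M * ENNReal.ofReal (Real.exp ε) := by
  classical
  set μ := Measure.pi fun _ : Fin n => pairLaw P κ with hμ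
  let B : Fin p → Set (Run n p) := fun j => {r | runKL j (pd j) (qd j) r ≤ (ε : EReal)}
  have hB : ∀ j, MeasurableSet (B j) := fun j =>
    measurable_runKL (hpd j).1 (hqd j).1 measurableSet_Iic
  have hst : ∀ j, Measurable fun w : Fin p → ℝ => ENNReal.ofReal (signTerm α w j) := fun j =>
    (measurable_signTerm α j).ennreal_ofReal
  have hms : ∀ j, Measurable fun r : Run n p => signTerm α (runStat W r) j := fun j =>
    (measurable_signTerm α j).comp hW.measurable_runStat
  have hind : ∀ (m : Fin M) (j : Fin p) (ω : Sample n p M),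
      (if klHat j (pd j) (qd j) m ω ≤ (ε : EReal) then
        signTerm α (runStat W (runOf m ω)) j else 0) =
      (B j).indicator (fun r => signTerm α (runStat W r) j) (runOf m ω) := fun m j ω => by
    simp only [klHat_eq_runKL, B, Set.indicator_apply, Set.mem_ofPred_eq]
    congr
  have hmeas : ∀ (m : Fin M) (j : Fin p), Measurable fun ω : Sample n p M =>
      (B j).indicator (fun r => signTerm α (runStat W r) j) (runOf m ω) := fun m j =>
    ((hms j).indicator (hB j)).comp (measurable_runOf m)
  have hnn : ∀ (j : Fin p) (r : Run n p),
      0 ≤ (B j).indicator (fun r => signTerm α (runStat W r) j) r := fun j r =>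
    Set.indicator_nonneg (fun _ _ => signTerm_nonneg _ _ _) r
  have hrun : ∀ m : Fin M, ∫⁻ ω, ∑ j ∈ nulls P, ENNReal.ofReal
      ((B j).indicator (fun r => signTerm α (runStat W r) j) (runOf m ω)) ∂(sampleLaw n M P κ) ≤
      ENNReal.ofReal (Real.exp ε) := by
    intro m
    have hflip : Measurable fun r : Run n p => fun j : Fin p =>
        Function.update (runStat W r) j (-runStat W r j) := by
      refine measurable_pi_lambda _ fun j => ?_
      simp only [← hW.runStat_rowSwap]
      refine hW.measurable_runStat.comp (measurable_pi_lambda _ fun i => ?_)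
      exact (measurable_rowSwap j).comp (measurable_pi_apply i)
    calc _ = ∫⁻ r, ∑ j ∈ nulls P, ENNReal.ofReal
          ((B j).indicator (fun r => signTerm α (runStat W r) j) r) ∂μ := by
          rw [hμ, ← sampleLaw_map_runOf P κ m, lintegral_map _ (measurable_runOf m)]
          exact Finset.measurable_fun_sum _ fun j _ =>
            ((hms j).indicator (hB j)).ennreal_ofReal
      _ = ∑ j ∈ nulls P, ∫⁻ r in B j, ENNReal.ofReal (signTerm α (runStat W r) j) ∂μ := by
          rw [lintegral_finsetSum _ fun j _ => ((hms j).indicator (hB j)).ennreal_ofReal]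
          refine Finset.sum_congr rfl fun j _ => ?_
          rw [← lintegral_indicator (hB j)]
          refine lintegral_congr fun r => ?_
          by_cases hr : r ∈ B j
          · simp [hr]
          · simp [hr]
      _ ≤ ∑ j ∈ nulls P, ENNReal.ofReal (Real.exp ε) * ∫⁻ r, ENNReal.ofReal
            (signTerm α (Function.update (runStat W r) j (-runStat W r j)) j) ∂μ := by
          refine Finset.sum_le_sum fun j hj => ?_
          exact setLIntegral_runStat_le (Finset.mem_filter.1 hj).2 (hκ j) (hpd j) (hqd j) hW ε
            (hst j)
      _ = ENNReal.ofReal (Real.exp ε) * ∫⁻ r, ∑ j ∈ nulls P, ENNReal.ofReal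
            (signTerm α (Function.update (runStat W r) j (-runStat W r j)) j) ∂μ := by
          rw [← Finset.mul_sum, lintegral_finsetSum]
          exact fun j _ => (hst j).comp ((measurable_pi_apply j).comp hflip)
      _ ≤ ENNReal.ofReal (Real.exp ε) * ∫⁻ _, 1 ∂μ := by
          gcongr with r
          rw [← ENNReal.ofReal_sum_of_nonneg fun j _ => signTerm_nonneg _ _ _,
            ENNReal.ofReal_le_one]
          -- After the flip the terms are bounded pointwise, so the sum may be enlarged from the
          -- nulls to all features.
          exact (Finset.sum_le_univ_sum_of_nonneg fun j => signTerm_nonneg _ _ _).trans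
            (sum_signTerm_flip_le_one α (runStat W r))
      _ = ENNReal.ofReal (Real.exp ε) := by simp
  constructor
  · unfold nullSum
    simp only [hind]
    exact Finset.measurable_fun_sum _ fun m _ => Finset.measurable_fun_sum _ fun j _ => hmeas m j
  · have hsum : ∀ ω : Sample n p M, ENNReal.ofReal (nullSum α W (nulls P) pd qd ε ω) =
        ∑ m : Fin M, ∑ j ∈ nulls P, ENNReal.ofReal
          ((B j).indicator (fun r => signTerm α (runStat W r) j) (runOf m ω)) := by
      intro ω
      simp only [nullSum, hind]
      rw [ENNReal.ofReal_sum_of_nonneg fun m _ => Finset.sum_nonneg fun j _ => hnn j _]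
      exact Finset.sum_congr rfl fun m _ => ENNReal.ofReal_sum_of_nonneg fun j _ => hnn j _
    simp only [hsum]
    rw [lintegral_finsetSum _ fun m _ =>
      Finset.measurable_fun_sum _ fun j _ => (hmeas m j).ennreal_ofReal]
    refine (Finset.sum_le_sum fun m _ => hrun m).trans_eq ?_
    simp

/-- Without measurability the Bochner integral is `0 ≤ c`, so the rejection set need not be shown
measurable. -/
lemma integral_le_of_lintegral_ofReal_le {Ω : Type*} [MeasurableSpace Ω] {μ : Measure Ω}
    {f : Ω → ℝ} (hf : ∀ ω, 0 ≤ f ω) {c : ℝ} (hc : 0 ≤ c)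
    (h : ∫⁻ ω, ENNReal.ofReal (f ω) ∂μ ≤ ENNReal.ofReal c) : ∫ ω, f ω ∂μ ≤ c := by
  by_cases hm : AEStronglyMeasurable f μ
  · rw [integral_eq_lintegral_of_nonneg_ae (Filter.Eventually.of_forall hf) hm]
    exact ENNReal.toReal_le_of_le_ofReal hc h
  · rwa [integral_non_aestronglyMeasurable hm]

open Classical in
/-- A random variable bounded by one which, off the event `A`, is at most the proportion of false
discoveries with empirical KL divergence at most `ε`. -/
lemma integral_le_exp_mul_add (hM : 1 ≤ M) (αkn : ℝ) {αebh : ℝ} (hα : 0 < αebh)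
    (hκ : ∀ j, PairwiseExchangeable κ j (Q j))
    (hpd : ∀ j, IsCondDensity ((P.map Prod.fst).map (rest j))
      (trueConditional (P.map Prod.fst) j) (ν j) (pd j))
    (hqd : ∀ j, IsCondDensity ((P.map Prod.fst).map (rest j)) (Q j) (ν j) (qd j))
    (hW : IsFeatureStatistic W) (ε : ℝ) (A : Set (Sample n p M)) {F : Sample n p M → ℝ}
    (hF : ∀ ω, 0 ≤ F ω) (hF1 : ∀ ω ∈ A, F ω ≤ 1)
    (hFA : ∀ ω ∉ A, F ω ≤ (((rejections αkn αebh W ω ∩ nulls P).filter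
        fun j => klMax j (pd j) (qd j) ω ≤ (ε : EReal)).card : ℝ) /
      max ((rejections αkn αebh W ω).card : ℝ) 1) :
    ∫ ω, F ω ∂(sampleLaw n M P κ) ≤ Real.exp ε * αebh + (sampleLaw n M P κ).real A := by
  have : IsProbabilityMeasure (rowLaw M P κ) := by
    have : IsMarkovKernel (iidKernel M κ) := ⟨fun a => by
      change IsProbabilityMeasure (Measure.pi fun _ => κ a)
      infer_instance⟩
    unfold rowLaw
    infer_instance
  have : IsProbabilityMeasure (sampleLaw n M P κ) := by
    unfold sampleLaw
    infer_instance
  obtain ⟨hmeas, hle⟩ := lintegral_nullSum_le (M := M) αkn hκ hpd hqd hW ε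
  have hM' : (0 : ℝ) < M := by exact_mod_cast hM
  have hc : 0 ≤ αebh / M := by positivity
  refine integral_le_of_lintegral_ofReal_le hF (by positivity) ?_
  calc ∫⁻ ω, ENNReal.ofReal (F ω) ∂(sampleLaw n M P κ)
      ≤ ∫⁻ ω, (ENNReal.ofReal (αebh / M) * ENNReal.ofReal (nullSum αkn W (nulls P) pd qd ε ω) +
          A.indicator 1 ω) ∂(sampleLaw n M P κ) := by
        refine lintegral_mono fun ω => ?_
        by_cases hω : ω ∈ A
        · rw [Set.indicator_of_mem hω]
          exact le_add_left (ENNReal.ofReal_le_one.2 (hF1 ω hω))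
        · rw [Set.indicator_of_notMem hω, add_zero, ← ENNReal.ofReal_mul hc]
          exact ENNReal.ofReal_le_ofReal ((hFA ω hω).trans (fdp_le_nullSum αkn hα W _ pd qd ε ω))
    _ ≤ ENNReal.ofReal (αebh / M) * (M * ENNReal.ofReal (Real.exp ε)) +
          sampleLaw n M P κ A := by
        rw [lintegral_add_left (hmeas.ennreal_ofReal.const_mul _),
          lintegral_const_mul _ hmeas.ennreal_ofReal]
        gcongr
        -- This inequality holds for arbitrary `A`, measurable or not.
        exact lintegral_indicator_one_le A
    _ = ENNReal.ofReal (Real.exp ε * αebh + (sampleLaw n M P κ).real A) := by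
        rw [ENNReal.ofReal_add (by positivity) (by positivity), ofReal_measureReal,
          ← ENNReal.ofReal_natCast, ← ENNReal.ofReal_mul hM'.le, ← ENNReal.ofReal_mul hc]
        congr 2
        field_simp

end Combine

end DerandKnockoffs

open DerandKnockoffs in
open Classical in
theorem theoremA2 {n p M : ℕ} (hM : 1 ≤ M) (αkn αebh : ℝ)
    (hαkn : αkn ∈ Set.Ioo (0 : ℝ) 1) (hαebh : αebh ∈ Set.Ioo (0 : ℝ) 1)
    -- the law of `(X, Y)`
    (P : Measure ((Fin p → ℝ) × ℝ)) [IsProbabilityMeasure P]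
    -- the estimated conditionals
    (Q : (j : Fin p) → Kernel (Rest p j) ℝ) [∀ j, IsMarkovKernel (Q j)]
    -- the knockoff mechanism
    (κ : Kernel (Fin p → ℝ) (Fin p → ℝ)) [IsMarkovKernel κ]
    (hκ : ∀ j, PairwiseExchangeable κ j (Q j))
    -- the conditional densities of the true and of the estimated conditionals
    (ν : (j : Fin p) → Rest p j → Measure ℝ)
    (pd qd : (j : Fin p) → Rest p j → ℝ → ℝ≥0)
    (hpd : ∀ j, IsCondDensity ((P.map Prod.fst).map (rest j))
      (trueConditional (P.map Prod.fst) j) (ν j) (pd j))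
    (hqd : ∀ j, IsCondDensity ((P.map Prod.fst).map (rest j)) (Q j) (ν j) (qd j))
    -- the feature importance statistic
    (W : (Fin n → Fin p → ℝ) → (Fin n → Fin p → ℝ) → (Fin n → ℝ) → Fin p → ℝ)
    (hW : IsFeatureStatistic W) :
    (∀ ε : ℝ, 0 ≤ ε →
      ∫ ω : Sample n p M,
        ((((rejections αkn αebh W ω ∩ nulls P).filter
            fun j => klMax j (pd j) (qd j) ω ≤ (ε : EReal)).card : ℝ) /
          max ((rejections αkn αebh W ω).card : ℝ) 1) ∂(sampleLaw n M P κ)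
        ≤ Real.exp ε * αebh) ∧
    fdr (sampleLaw n M P κ) (nulls P) (rejections αkn αebh W) ≤
      ⨅ ε : Set.Ioi (0 : ℝ), (Real.exp ε * αebh +
        (sampleLaw n M P κ).real {ω | ((ε : ℝ) : EReal) ≤ ⨆ j, klMax j (pd j) (qd j) ω}) := by
  have hα := hαebh.1
  refine ⟨fun ε hε => ?_, ?_⟩
  · have h := integral_le_exp_mul_add hM αkn hα hκ hpd hqd hW ε ∅ (P := P)
      (F := fun ω => (((rejections αkn αebh W ω ∩ nulls P).filter
        fun j => klMax j (pd j) (qd j) ω ≤ (ε : EReal)).card : ℝ) /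
          max ((rejections αkn αebh W ω).card : ℝ) 1)
      (fun ω => by positivity) (fun ω hω => absurd hω (Set.notMem_empty ω)) fun ω _ => le_rfl
    simpa only [measureReal_empty, add_zero] using h
  · refine le_ciInf fun ε => ?_
    -- The exceptional event is that some divergence reaches `ε`: there the proportion is at most
    -- one, and off it the restriction on the divergence discards no feature.
    refine integral_le_exp_mul_add hM αkn hα hκ hpd hqd hW ε _ (fun ω => by positivity)
      (fun ω _ => ?_) fun ω hω => ?_
    · refine div_le_one_of_le₀ (le_max_of_le_left ?_) (by positivity)
      exact_mod_cast Finset.card_le_card Finset.inter_subset_left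
    · have hlt : ⨆ j, klMax j (pd j) (qd j) ω < ((ε : ℝ) : EReal) := not_le.1 hω
      rw [Finset.filter_true_of_mem fun j _ =>
        ((le_iSup (fun j => klMax j (pd j) (qd j) ω) j).trans_lt hlt).le]
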